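/- Let $\mathcal H$ be a complex Hilbert space with orthonormal basis $\{e_n\}_{n\ge1}$, and let $\{X_n\}_{n\ge1}$ be i.i.d. nonnegative, (essentially) bounded real random variables on a probability space $(\Omega,\mathcal F,\mathbb P)$. Let $T=T(\omega)$ be the random weighted shift, i.e. the bounded operator with $Te_n=X_ne_{n+1}$ for all $n$ (almost surely well defined). Let $\operatorname{ess\,ran}X_1=\{t\in\mathbb R:\mathbb P(|X_1-t|<\varepsilon)>0\ \ \forall\varepsilon>0\}$, $r=\min\operatorname{ess\,ran}X_1$, $R=\max\operatorname{ess\,ran}X_1$, and assume $R>0$. Write $B(0,s)=\{z\in\mathbb C:|z|<s\}$ and $\overline{B(0,s)}=\{z\in\mathbb C:|z|\le s\}$. For a bounded operator $A$ on $\mathcal H$ let $\sigma(A)$ be its spectrum, $\gamma(A)$ its spectral radius, $\|A\|_e=\inf\{\|A+K\|: K\text{ compact}\}$ its essential norm, $W(A)=\{\langle Ax,x\rangle:\|x\|=1\}$ its numerical range, $w(A)=\sup_{z\in W(A)}|z|$ its numerical radius, and $W_e(A)=\bigcap_{K\text{ compact}}\overline{W(A+K)}$ its essential numerical range. Let $\sigma_p(A)$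 be the set of eigenvalues of $A$, and let $\sigma_\delta(A)$, $\sigma_\pi(A)$, $\sigma_e(A)$, $\sigma_{lre}(A)$ be the sets of $\lambda\in\mathbb C$ for which $A-\lambda$ is, respectively, not surjective, not bounded below, not Fredholm, not semi-Fredholm (semi-Fredholm: closed range, and kernel or cokernel finite-dimensional). For Fredholm $A$, $\operatorname{ind}A=\dim\ker A-\dim(\mathcal H/\operatorname{ran}A)$. Then: 1. Almost surely $\|T\|=\|T\|_e=\gamma(T)=w(T)=R$. 2. Almost surely $\sigma(T)=\sigma_\delta(T)=\overline{B(0,R)}$. 3. Almost surely $\sigma_\pi(T)=\sigma_e(T)=\sigma_{lre}(T)=\{z\in\mathbb C:r\le|z|\le R\}$, and almost surely, for every $\lambda\in B(0,r)$, $T-\lambda$ is Fredholm with $\operatorname{ind}(T-\lambda)=-1$. 4. If $\mathbb P(X_1=0)>0$, then almost surely $\sigma_p(T)=\sigma_p(T^*)=\{0\}$ and $\dim\ker T=\dim\ker T^*=\infty$. 5. If $\mathbb P(X_1=0)=0$, then almost surely $\sigma_p(T)=\emptyset$, $\sigma_p(T^*)=\{0\}\cup B(0,e^{\mathbb E(\ln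 X_1)})$, and $\dim\ker(T^*-\lambda)=1$ for every $\lambda\in\sigma_p(T^*)$. Here $\mathbb E(\ln X_1)\in[-\infty,\infty)$ and $e^{-\infty}=0$. 6. Almost surely $W(T)=B(0,R)$, and almost surely $W_e(T)=\overline{B(0,R)}$. -/

import Mathlib

open MeasureTheory ProbabilityTheory
open scoped ENNReal

noncomputable section

namespace RandomShift

section WeightedShift

variable {H : Type*} [NormedAddCommGroup H] [InnerProductSpace ℂ H]

/-- The coordinates `(0, w₀ x₀, w₁ x₁, …)` of the weighted shift of `x`. -/
def shiftCoord (w : ℕ → ℝ) (x : ℕ → ℂ) : ℕ → ℂ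
  | 0 => 0
  | n + 1 => (w n : ℂ) * x n

theorem norm_shiftCoord_succ_le {w : ℕ → ℝ} {C : ℝ} (hC : ∀ n, |w n| ≤ C) (x : ℕ → ℂ) (n : ℕ) :
    ‖shiftCoord w x (n + 1)‖ ≤ C * ‖x n‖ := by
  simp only [shiftCoord, norm_mul, Complex.norm_real, Real.norm_eq_abs]
  exact mul_le_mul_of_nonneg_right (hC n) (norm_nonneg _)

theorem summable_shiftCoord {w : ℕ → ℝ} {C : ℝ} (hC : ∀ n, |w n| ≤ C)
    (x : lp (fun _ : ℕ => ℂ) 2) : Summable fun n => ‖shiftCoord w x (n + 1)‖ ^ 2 := by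
  have hx : Summable fun n => ‖x n‖ ^ 2 := by
    have h := (memℓp_gen_iff (by norm_num : 0 < (2 : ℝ≥0∞).toReal)).1 (lp.memℓp x)
    simpa using h
  refine Summable.of_nonneg_of_le (fun _ => sq_nonneg _) (fun n => ?_) (hx.mul_left (C ^ 2))
  rw [← mul_pow]
  exact pow_le_pow_left₀ (norm_nonneg _) (norm_shiftCoord_succ_le hC x n) 2

theorem memℓp_shiftCoord {w : ℕ → ℝ} {C : ℝ} (hC : ∀ n, |w n| ≤ C)
    (x : lp (fun _ : ℕ => ℂ) 2) : Memℓp (shiftCoord w x) 2 := by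
  refine memℓp_gen ?_
  simp only [ENNReal.toReal_ofNat, Real.rpow_ofNat]
  exact (summable_nat_add_iff 1).1 (summable_shiftCoord hC x)

/-- The weighted shift on `ℓ²` with bounded weights, as a linear map. -/
def shiftLin (w : ℕ → ℝ) (C : ℝ) (hC : ∀ n, |w n| ≤ C) :
    lp (fun _ : ℕ => ℂ) 2 →ₗ[ℂ] lp (fun _ : ℕ => ℂ) 2 where
  toFun x := ⟨shiftCoord w x, memℓp_shiftCoord hC x⟩
  map_add' x y := by
    ext n
    change shiftCoord w (x + y : lp (fun _ : ℕ => ℂ) 2) n = shiftCoord w x n + shiftCoord w y n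
    cases n with
    | zero => simp [shiftCoord]
    | succ n => simp [shiftCoord, mul_add]
  map_smul' c x := by
    ext n
    change shiftCoord w (c • x : lp (fun _ : ℕ => ℂ) 2) n = c * shiftCoord w x n
    cases n with
    | zero => simp [shiftCoord]
    | succ n => simp [shiftCoord, mul_left_comm]

theorem norm_sq_eq_tsum (y : lp (fun _ : ℕ => ℂ) 2) : ‖y‖ ^ 2 = ∑' n, ‖y n‖ ^ 2 := by
  have h := lp.norm_rpow_eq_tsum (by norm_num : 0 < (2 : ℝ≥0∞).toReal) y
  simpa using h

theorem norm_shiftLin_le (w : ℕ → ℝ) (C : ℝ) (hC : ∀ n, |w n| ≤ C)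
    (x : lp (fun _ : ℕ => ℂ) 2) : ‖shiftLin w C hC x‖ ≤ C * ‖x‖ := by
  have hC0 : 0 ≤ C := (abs_nonneg _).trans (hC 0)
  have hx : Summable fun n => ‖x n‖ ^ 2 := by
    have h := (memℓp_gen_iff (by norm_num : 0 < (2 : ℝ≥0∞).toReal)).1 (lp.memℓp x)
    simpa using h
  have hs := summable_shiftCoord hC x
  have h0 : ‖shiftCoord w x 0‖ ^ 2 = 0 := by simp [shiftCoord]
  have hsum : ∑' n, ‖shiftCoord w x n‖ ^ 2 ≤ ∑' n, C ^ 2 * ‖x n‖ ^ 2 := by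
    have h1 : Summable fun n => ‖shiftCoord w x n‖ ^ 2 :=
      (summable_nat_add_iff (f := fun n => ‖shiftCoord w x n‖ ^ 2) 1).1 hs
    rw [h1.tsum_eq_zero_add, h0, zero_add]
    refine Summable.tsum_le_tsum (fun n => ?_) hs (hx.mul_left (C ^ 2))
    rw [← mul_pow]
    exact pow_le_pow_left₀ (norm_nonneg _) (norm_shiftCoord_succ_le hC x n) 2
  have hsq : ‖shiftLin w C hC x‖ ^ 2 ≤ (C * ‖x‖) ^ 2 := by
    rw [mul_pow, norm_sq_eq_tsum x, ← tsum_mul_left]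
    exact (norm_sq_eq_tsum (shiftLin w C hC x)).trans_le hsum
  exact (sq_le_sq₀ (norm_nonneg _) (mul_nonneg hC0 (norm_nonneg _))).1 hsq

/-- The bounded weighted shift on `ℓ²` with weights bounded by `C`. -/
def shiftL2 (w : ℕ → ℝ) (C : ℝ) (hC : ∀ n, |w n| ≤ C) :
    lp (fun _ : ℕ => ℂ) 2 →L[ℂ] lp (fun _ : ℕ => ℂ) 2 :=
  (shiftLin w C hC).mkContinuous C (norm_shiftLin_le w C hC)

open Classical in
/-- The unilateral weighted shift `e n ↦ w n • e (n + 1)` on a Hilbert space with orthonormal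
basis `e`, as a bounded operator; by convention it is `0` if the weights are unbounded. -/
def weightedShift (e : HilbertBasis ℕ ℂ H) (w : ℕ → ℝ) : H →L[ℂ] H :=
  if h : ∃ C, ∀ n, |w n| ≤ C then
    (e.repr.symm.toContinuousLinearEquiv : lp (fun _ : ℕ => ℂ) 2 →L[ℂ] H) ∘L
      shiftL2 w h.choose h.choose_spec ∘L
      (e.repr.toContinuousLinearEquiv : H →L[ℂ] lp (fun _ : ℕ => ℂ) 2)
  else 0

theorem weightedShift_apply_basis (e : HilbertBasis ℕ ℂ H) {w : ℕ → ℝ}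
    (h : ∃ C, ∀ n, |w n| ≤ C) (n : ℕ) :
    weightedShift e w (e n) = (w n : ℂ) • e (n + 1) := by
  classical
  rw [weightedShift, dif_pos h]
  apply e.repr.injective
  ext k
  simp only [ContinuousLinearMap.comp_apply, map_smul]
  rw [show (e.repr.toContinuousLinearEquiv : H →L[ℂ] lp (fun _ : ℕ => ℂ) 2) (e n)
      = e.repr (e n) from rfl]
  rw [show ∀ y, (e.repr.symm.toContinuousLinearEquiv : lp (fun _ : ℕ => ℂ) 2 →L[ℂ] H) y
      = e.repr.symm y from fun _ => rfl]
  rw [e.repr.apply_symm_apply, e.repr_self, e.repr_self]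
  change shiftCoord w (lp.single 2 n (1 : ℂ) : lp (fun _ : ℕ => ℂ) 2) k
    = (w n : ℂ) * (lp.single 2 (n + 1) (1 : ℂ) : lp (fun _ : ℕ => ℂ) 2) k
  cases k with
  | zero => simp [shiftCoord]
  | succ k =>
    by_cases hk : k = n
    · subst hk; simp [shiftCoord]
    · simp [shiftCoord, hk]

end WeightedShift

section Operators

variable {H : Type*} [NormedAddCommGroup H] [InnerProductSpace ℂ H]

/-- `A - λ`. -/
def shifted (A : H →L[ℂ] H) (z : ℂ) : H →L[ℂ] H := A - z • ContinuousLinearMap.id ℂ H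

/-- The point spectrum `σ_p(A)`: the set of eigenvalues. -/
def pointSpectrum (A : H →L[ℂ] H) : Set ℂ :=
  {z | Module.End.HasEigenvalue (A : H →ₗ[ℂ] H) z}

/-- The approximate point spectrum `σ_π(A)`: `A - z` is not bounded below. -/
def approxPointSpectrum (A : H →L[ℂ] H) : Set ℂ :=
  {z | ¬ ∃ c : ℝ, 0 < c ∧ ∀ x, c * ‖x‖ ≤ ‖shifted A z x‖}

/-- The approximate defect spectrum `σ_δ(A)`: `A - z` is not surjective. -/
def approxDefectSpectrum (A : H →L[ℂ] H) : Set ℂ :=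
  {z | ¬ Function.Surjective (shifted A z)}

/-- Semi-Fredholm: closed range, and finite-dimensional kernel or cokernel. -/
def IsSemiFredholm (A : H →L[ℂ] H) : Prop :=
  IsClosed (A.range : Set H) ∧
    (FiniteDimensional ℂ A.ker ∨ FiniteDimensional ℂ (H ⧸ A.range))

/-- The essential spectrum `σ_e(A)`: `A - z` is not Fredholm. -/
def essSpectrum (A : H →L[ℂ] H) : Set ℂ :=
  {z | ¬ (shifted A z).IsFredholm}

/-- The Wolf spectrum `σ_lre(A)`: `A - z` is not semi-Fredholm. -/
def wolfSpectrum (A : H →L[ℂ] H) : Set ℂ :=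
  {z | ¬ IsSemiFredholm (shifted A z)}

/-- The index `dim ker A - dim coker A` of a Fredholm operator; it is meaningful only together
with `A.IsFredholm`. -/
def index (A : H →L[ℂ] H) : ℤ :=
  (Module.finrank ℂ A.ker : ℤ) - (Module.finrank ℂ (H ⧸ A.range) : ℤ)

/-- The essential norm: the infimum of `‖A + K‖` over compact operators `K`. -/
def essNorm (A : H →L[ℂ] H) : ℝ :=
  sInf {c | ∃ K : H →L[ℂ] H, IsCompactOperator K ∧ c = ‖A + K‖}

/-- The numerical range. -/
def numericalRange (A : H →L[ℂ] H) : Set ℂ :=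
  {z | ∃ x : H, ‖x‖ = 1 ∧ z = inner ℂ x (A x)}

/-- The numerical radius: the supremum of `|z|` over the (bounded) numerical range. -/
def numericalRadius (A : H →L[ℂ] H) : ℝ :=
  sSup {c | ∃ z ∈ numericalRange A, c = ‖z‖}

/-- The essential numerical range: the intersection of the closures of `W(A + K)` over compact
operators `K`. -/
def essNumericalRange (A : H →L[ℂ] H) : Set ℂ :=
  {z | ∀ K : H →L[ℂ] H, IsCompactOperator K → z ∈ closure (numericalRange (A + K))}

end Operators

section Probability

variable {Ω : Type*} [MeasurableSpace Ω]

/-- The essential range of a real random variable. -/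
def essRan (P : Measure Ω) (Y : Ω → ℝ) : Set ℝ :=
  {t | ∀ ε > 0, 0 < P {ω | |Y ω - t| < ε}}

/-- The expectation `E(Y⁺) - E(Y⁻)` in `[-∞, ∞]` (meaningful if one of the two is finite). -/
def expectation (P : Measure Ω) (Y : Ω → ℝ) : EReal :=
  ((∫⁻ ω, ENNReal.ofReal (Y ω) ∂P : ℝ≥0∞) : EReal) -
    ((∫⁻ ω, ENNReal.ofReal (-Y ω) ∂P : ℝ≥0∞) : EReal)

/-- `exp (E (ln Y))` in `[0, ∞]`, where `exp (-∞) = 0`. -/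
def geomMean (P : Measure Ω) (Y : Ω → ℝ) : ℝ≥0∞ :=
  EReal.exp (expectation P fun ω => Real.log (Y ω))

end Probability

end RandomShift

end

/-!
By Borel–Cantelli, almost every sample contains, arbitrarily far out, arbitrarily long blocks of
weights close to `R`, followed by arbitrarily long blocks of weights close to `r`. On a block with
weights close to `R` there are unit vectors on which the quadratic form takes any prescribed value
in the open disc of radius `R`. These vectors tend weakly to zero, so compact perturbations do not
see them; this gives the two numerical ranges and all the norms. On a double block, solving the
eigenvalue equation produces approximate eigenvectors for `r ≤ |z| ≤ R`. For `|z| < r` the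
operator `T - z` is bounded below with one-dimensional cokernel, so its index is `-1`.

If no weight vanishes, `z` is an eigenvalue of `T*` if and only if
`F(X) = ∑ n, ∏ i < n, (|z| / X i)²` is finite. The strong law of large numbers gives convergence
for `|z| < exp E(ln X 0)`. Conversely, `F(X) = 1 + (|z| / X 0)² F(θX)` with `θ` the left shift, so
finiteness of `F` with positive probability makes `2 (ln X 0 - ln |z|)` strictly larger than the
coboundary `ln F(θX) - ln F(X)` on the event `F(θX) < ∞`, which is independent of `X 0`. A
coboundary has mean zero by stationarity, even when `ln F(X)` is not integrable, whence
`ln |z| < E(ln X 0)`; in particular there is no convergence at the threshold itself.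
-/

noncomputable section

namespace RandomShift

open Filter Topology Finset
open ContinuousLinearMap (adjoint)
open scoped ComplexConjugate

section Operators

variable {H : Type*} [NormedAddCommGroup H] [InnerProductSpace ℂ H] {A : H →L[ℂ] H} {z : ℂ}

theorem shifted_apply (A : H →L[ℂ] H) (z : ℂ) (x : H) : shifted A z x = A x - z • x := rfl

theorem adjoint_shifted [CompleteSpace H] (A : H →L[ℂ] H) (z : ℂ) :
    adjoint (shifted A z) = shifted (adjoint A) (conj z) := by
  rw [shifted, shifted, map_sub, map_smulₛₗ, ContinuousLinearMap.adjoint_id]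

theorem mem_pointSpectrum_iff_ker_ne_bot : z ∈ pointSpectrum A ↔ (shifted A z).ker ≠ ⊥ := by
  rw [pointSpectrum, Set.mem_ofPred_eq, Module.End.hasEigenvalue_iff, Module.End.eigenspace_def]
  rfl

theorem mem_pointSpectrum_iff_exists : z ∈ pointSpectrum A ↔ ∃ x ≠ 0, A x = z • x := by
  rw [mem_pointSpectrum_iff_ker_ne_bot, Submodule.ne_bot_iff]
  refine exists_congr fun x => ?_
  rw [and_comm, LinearMap.mem_ker]
  exact and_congr_right fun _ => sub_eq_zero

theorem notMem_pointSpectrum_iff_injective :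
    z ∉ pointSpectrum A ↔ Function.Injective (shifted A z) := by
  rw [mem_pointSpectrum_iff_ker_ne_bot, not_not]
  exact LinearMap.ker_eq_bot

theorem mem_approxPointSpectrum_of_forall_exists_lt
    (h : ∀ c > 0, ∃ x, ‖shifted A z x‖ < c * ‖x‖) : z ∈ approxPointSpectrum A := by
  rintro ⟨c, hc, hle⟩
  obtain ⟨x, hx⟩ := h c hc
  exact (hle x).not_gt hx

theorem notMem_approxPointSpectrum_iff :
    z ∉ approxPointSpectrum A ↔ ∃ K, AntilipschitzWith K (shifted A z) := by
  rw [approxPointSpectrum, Set.mem_ofPred_eq, not_not]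
  constructor
  · rintro ⟨c, hc, h⟩
    refine ⟨Real.toNNReal c⁻¹, (shifted A z).antilipschitz_of_bound fun x => ?_⟩
    rw [Real.coe_toNNReal _ (by positivity), inv_mul_eq_div, le_div_iff₀' hc]
    exact h x
  · rintro ⟨K, hK⟩
    refine ⟨((K : ℝ) + 1)⁻¹, by positivity, fun x => ?_⟩
    rw [inv_mul_le_iff₀ (by positivity)]
    exact ((shifted A z).bound_of_antilipschitz hK x).trans (by gcongr; linarith)

theorem isFredholm_of_antilipschitz [CompleteSpace H] {K : NNReal} (hA : AntilipschitzWith K A)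
    (hfin : FiniteDimensional ℂ (H ⧸ A.range)) : A.IsFredholm :=
  have hker : A.ker = ⊥ := LinearMap.ker_eq_bot.2 hA.injective
  { isStrictMap :=
      (hA.isClosedEmbedding A.uniformContinuous).isClosedMap.isStrictMap A.continuous
    isClosed_range := hA.isClosed_range A.uniformContinuous
    finite_ker := by rw [hker]; infer_instance
    finite_coker := hfin
    closedComplemented_ker := by rw [hker]; exact Submodule.closedComplemented_bot }

theorem exists_equiv_of_notMem_spectrum (hz : z ∉ spectrum ℂ A) :
    ∃ f : H ≃L[ℂ] H, ⇑f = shifted A z := by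
  obtain ⟨u, hu⟩ := (spectrum.notMem_iff.1 hz).neg
  exact ⟨ContinuousLinearEquiv.unitsEquiv ℂ H u, congrArg DFunLike.coe (hu.trans (neg_sub _ _))⟩

theorem approxDefectSpectrum_subset_spectrum (A : H →L[ℂ] H) :
    approxDefectSpectrum A ⊆ spectrum ℂ A := fun z => not_imp_not.1 fun hz => by
  obtain ⟨f, hf⟩ := exists_equiv_of_notMem_spectrum hz
  exact not_not.2 (hf ▸ f.surjective)

theorem approxPointSpectrum_subset_spectrum (A : H →L[ℂ] H) :
    approxPointSpectrum A ⊆ spectrum ℂ A := fun z => not_imp_not.1 fun hz => by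
  obtain ⟨f, hf⟩ := exists_equiv_of_notMem_spectrum hz
  exact notMem_approxPointSpectrum_iff.2 ⟨_, hf ▸ f.antilipschitz⟩

theorem essSpectrum_subset_spectrum [CompleteSpace H] (A : H →L[ℂ] H) :
    essSpectrum A ⊆ spectrum ℂ A := fun z => not_imp_not.1 fun hz => by
  obtain ⟨f, hf⟩ := exists_equiv_of_notMem_spectrum hz
  refine not_not.2 (isFredholm_of_antilipschitz (hf ▸ f.antilipschitz) ?_)
  rw [LinearMap.range_eq_top.2 (hf ▸ f.surjective)]
  infer_instance

theorem wolfSpectrum_subset_essSpectrum (A : H →L[ℂ] H) : wolfSpectrum A ⊆ essSpectrum A :=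
  fun _ hz h => hz ⟨h.isClosed_range, Or.inl h.finite_ker⟩

theorem wolfSpectrum_subset_approxDefectSpectrum (A : H →L[ℂ] H) :
    wolfSpectrum A ⊆ approxDefectSpectrum A := fun z hz hs => hz <| by
  rw [IsSemiFredholm, LinearMap.range_eq_top.2 hs]
  exact ⟨isClosed_univ, Or.inr inferInstance⟩

theorem mem_wolfSpectrum_of_injective [CompleteSpace H] (hz : z ∈ approxPointSpectrum A)
    (hinj : Function.Injective (shifted A z)) : z ∈ wolfSpectrum A := fun h =>
  notMem_approxPointSpectrum_iff.2
    ((shifted A z).antilipschitz_of_injective_of_isClosed_range hinj h.1) hz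

/-- The cokernel of an operator with closed range, identified with the kernel of the adjoint. -/
def cokerEquivKerAdjoint [CompleteSpace H] (A : H →L[ℂ] H) (hA : IsClosed (A.range : Set H)) :
    (H ⧸ A.range) ≃ₗ[ℂ] (adjoint A).ker :=
  haveI : CompleteSpace A.range := hA.completeSpace_coe
  (Submodule.quotientEquivOfIsCompl _ _ (Submodule.isCompl_orthogonal _)).trans
    (LinearEquiv.ofEq _ _ A.orthogonal_range)

theorem not_isSemiFredholm_of_ker [CompleteSpace H] (hA : ¬ FiniteDimensional ℂ A.ker)
    (hA' : ¬ FiniteDimensional ℂ (adjoint A).ker) : ¬ IsSemiFredholm A := by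
  rintro ⟨hclosed, hfin | hfin⟩
  · exact hA hfin
  · exact hA' (cokerEquivKerAdjoint A hclosed).finiteDimensional

theorem index_of_antilipschitz [CompleteSpace H] {K : NNReal} (hA : AntilipschitzWith K A) :
    index A = -Module.finrank ℂ (adjoint A).ker := by
  have hclosed : IsClosed (A.range : Set H) := hA.isClosed_range A.uniformContinuous
  rw [index, (cokerEquivKerAdjoint A hclosed).finrank_eq, LinearMap.ker_eq_bot.2 hA.injective,
    finrank_bot, Nat.cast_zero, zero_sub]

theorem spectralRadius_eq_of_spectrum_eq_closedBall {R : ℝ} (hR : 0 ≤ R)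
    (h : spectrum ℂ A = Metric.closedBall 0 R) : spectralRadius ℂ A = ENNReal.ofReal R := by
  simp_rw [spectralRadius, h, ← enorm_eq_nnnorm, ← ofReal_norm]
  refine le_antisymm (iSup₂_le fun z hz => ?_) ?_
  · exact ENNReal.ofReal_le_ofReal (mem_closedBall_zero_iff.1 hz)
  · have hnorm : ‖(R : ℂ)‖ = R := by rw [Complex.norm_real, Real.norm_of_nonneg hR]
    refine le_iSup₂_of_le (R : ℂ) (mem_closedBall_zero_iff.2 hnorm.le) ?_
    rw [hnorm]

theorem numericalRange_subset_closedBall (A : H →L[ℂ] H) :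
    numericalRange A ⊆ Metric.closedBall 0 ‖A‖ := by
  rintro _ ⟨x, hx, rfl⟩
  rw [mem_closedBall_zero_iff]
  refine (norm_inner_le_norm _ _).trans ?_
  simpa [hx] using A.le_opNorm x

theorem exists_eq_smul_of_norm_inner_eq {x : H} (hx : ‖x‖ = 1) (hA : A ≠ 0)
    (h : ‖(inner ℂ x (A x) : ℂ)‖ = ‖A‖) : ∃ c : ℂ, c ≠ 0 ∧ A x = c • x := by
  have hAx : ‖A x‖ = ‖A‖ := by
    refine le_antisymm (by simpa [hx] using A.le_opNorm x) ?_
    simpa [h, hx] using norm_inner_le_norm (𝕜 := ℂ) x (A x)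
  have hx0 : x ≠ 0 := norm_ne_zero_iff.1 (hx ▸ one_ne_zero)
  have hAx0 : A x ≠ 0 := norm_ne_zero_iff.1 (hAx ▸ norm_ne_zero_iff.2 hA)
  exact (norm_inner_eq_norm_iff (𝕜 := ℂ) hx0 hAx0).1 (by rw [h, hx, hAx, one_mul])

theorem numericalRadius_eq_of_numericalRange_eq_ball {R : ℝ} (hR : 0 < R)
    (h : numericalRange A = Metric.ball 0 R) : numericalRadius A = R := by
  rw [numericalRadius, h]
  refine csSup_eq_of_forall_le_of_forall_lt_exists_gt ⟨0, 0, Metric.mem_ball_self hR, by simp⟩ ?_ ?_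
  · rintro _ ⟨z, hz, rfl⟩
    exact (mem_ball_zero_iff.1 hz).le
  · intro c hc
    obtain ⟨b, hb, hbR⟩ := exists_between (max_lt hc hR)
    have hnorm : ‖(b : ℂ)‖ = b := by
      rw [Complex.norm_real, Real.norm_of_nonneg ((le_max_right _ _).trans hb.le)]
    exact ⟨b, ⟨b, by rwa [mem_ball_zero_iff, hnorm], hnorm.symm⟩, (le_max_left _ _).trans_lt hb⟩

theorem essNorm_le_norm (A : H →L[ℂ] H) : essNorm A ≤ ‖A‖ := by
  refine csInf_le ⟨0, ?_⟩ ⟨0, isCompactOperator_zero, by rw [add_zero]⟩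
  rintro _ ⟨K, -, rfl⟩
  exact norm_nonneg _

theorem norm_le_essNorm_of_mem_essNumericalRange (hz : z ∈ essNumericalRange A) :
    ‖z‖ ≤ essNorm A := by
  refine le_csInf ⟨_, 0, isCompactOperator_zero, rfl⟩ ?_
  rintro _ ⟨K, hK, rfl⟩
  exact mem_closedBall_zero_iff.1 <| closure_minimal (numericalRange_subset_closedBall _)
    Metric.isClosed_closedBall (hz K hK)

theorem essNumericalRange_subset_closure_numericalRange (A : H →L[ℂ] H) :
    essNumericalRange A ⊆ closure (numericalRange A) := fun z hz => by
  simpa only [add_zero] using hz 0 isCompactOperator_zero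

theorem isClosed_essNumericalRange (A : H →L[ℂ] H) : IsClosed (essNumericalRange A) := by
  simp only [essNumericalRange, Set.ofPred_forall]
  exact isClosed_iInter fun _ => isClosed_iInter fun _ => isClosed_closure

section WeaklyNull

variable [CompleteSpace H] {x : ℕ → H} (hx : ∀ n, ‖x n‖ = 1)
  (hweak : ∀ v, Tendsto (fun n => (inner ℂ v (x n) : ℂ)) atTop (𝓝 0))

include hx hweak

theorem exists_strictMono_tendsto_zero_of_isCompactOperator {K : H →L[ℂ] H}
    (hK : IsCompactOperator K) :
    ∃ φ : ℕ → ℕ, StrictMono φ ∧ Tendsto (fun n => K (x (φ n))) atTop (𝓝 0) := by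
  obtain ⟨C, hC, hsub⟩ := hK.image_closedBall_subset_compact (f := (K : H →ₗ[ℂ] H)) 1
  obtain ⟨y, -, φ, hφ, hlim⟩ := hC.tendsto_subseq (x := fun n => K (x n)) fun n =>
    hsub ⟨x n, by simp [hx n], rfl⟩
  refine ⟨φ, hφ, ?_⟩
  suffices y = 0 by rwa [this] at hlim
  have h1 : Tendsto (fun n => (inner ℂ y (K (x (φ n))) : ℂ)) atTop (𝓝 (inner ℂ y y)) :=
    tendsto_const_nhds.inner hlim
  have h2 : Tendsto (fun n => (inner ℂ y (K (x (φ n))) : ℂ)) atTop (𝓝 0) := by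
    simp_rw [← ContinuousLinearMap.adjoint_inner_left]
    exact (hweak _).comp hφ.tendsto_atTop
  exact inner_self_eq_zero.1 (tendsto_nhds_unique h1 h2)

theorem mem_essNumericalRange_of_weaklyNull (hz : ∀ n, inner ℂ (x n) (A (x n)) = z) :
    z ∈ essNumericalRange A := by
  intro K hK
  obtain ⟨φ, -, hφ⟩ := exists_strictMono_tendsto_zero_of_isCompactOperator hx hweak hK
  have hKx : Tendsto (fun n => (inner ℂ (x (φ n)) (K (x (φ n))) : ℂ)) atTop (𝓝 0) := by
    refine squeeze_zero_norm (fun n => ?_) (tendsto_norm_zero.comp hφ)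
    simpa [hx] using norm_inner_le_norm (𝕜 := ℂ) (x (φ n)) (K (x (φ n)))
  refine mem_closure_of_tendsto (by simpa using hKx.const_add z)
    (Eventually.of_forall fun n => ⟨x (φ n), hx _, ?_⟩)
  rw [add_apply, inner_add_right, hz]

end WeaklyNull

end Operators

/-! ### Weighted shifts along an orthonormal basis -/

section Basis

variable {H : Type*} [NormedAddCommGroup H] [InnerProductSpace ℂ H] {e : HilbertBasis ℕ ℂ H}

theorem inner_basis (e : HilbertBasis ℕ ℂ H) (m n : ℕ) :
    inner ℂ (e m) (e n) = if m = n then (1 : ℂ) else 0 :=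
  orthonormal_iff_ite.1 e.orthonormal m n

theorem norm_basis (e : HilbertBasis ℕ ℂ H) (n : ℕ) : ‖e n‖ = 1 := e.orthonormal.1 n

theorem hasSum_norm_sq_repr (e : HilbertBasis ℕ ℂ H) (x : H) :
    HasSum (fun n => ‖e.repr x n‖ ^ 2) (‖x‖ ^ 2) := by
  have h : Summable fun n => ‖e.repr x n‖ ^ 2 := by
    simpa using (memℓp_gen_iff (by norm_num : 0 < (2 : ℝ≥0∞).toReal)).1 (lp.memℓp (e.repr x))
  rw [← e.repr.norm_map, norm_sq_eq_tsum]
  exact h.hasSum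

theorem eq_of_repr_eq {x y : H} (h : ∀ n, e.repr x n = e.repr y n) : x = y :=
  e.repr.injective (lp.ext (funext h))

theorem not_finiteDimensional_of_forall_basis_mem {p : Submodule ℂ H} {f : ℕ → ℕ}
    (hf : Function.Injective f) (h : ∀ n, e (f n) ∈ p) : ¬ FiniteDimensional ℂ p := by
  intro hfin
  have hli : LinearIndependent ℂ fun n => (⟨e (f n), h n⟩ : p) :=
    LinearIndependent.of_comp p.subtype (e.orthonormal.linearIndependent.comp f hf)
  exact not_finite_iff_infinite.2 (inferInstance : Infinite ℕ) hli.finite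

theorem tendsto_inner_zero_of_support {x : ℕ → H} (hx : ∀ n, ‖x n‖ = 1)
    (hsupp : ∀ n, ∀ k < n, inner ℂ (e k) (x n) = 0) (v : H) :
    Tendsto (fun n => (inner ℂ v (x n) : ℂ)) atTop (𝓝 0) := by
  let s : ℕ → H := fun n => ∑ k ∈ range n, e.repr v k • e k
  have hs : Tendsto (fun n => ‖v - s n‖) atTop (𝓝 0) := by
    simpa using ((e.hasSum_repr v).tendsto_sum_nat.const_sub v).norm
  refine squeeze_zero_norm (fun n => ?_) hs
  have horth : inner ℂ (s n) (x n) = 0 := by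
    rw [sum_inner]
    refine sum_eq_zero fun k hk => ?_
    rw [inner_smul_left, hsupp n k (mem_range.1 hk), mul_zero]
  calc ‖inner ℂ v (x n)‖ = ‖inner ℂ (v - s n) (x n)‖ := by rw [inner_sub_left, horth, sub_zero]
    _ ≤ ‖v - s n‖ * ‖x n‖ := norm_inner_le_norm _ _
    _ = ‖v - s n‖ := by rw [hx, mul_one]

end Basis

section BlockVec

variable {H : Type*} [NormedAddCommGroup H] [InnerProductSpace ℂ H] {e : HilbertBasis ℕ ℂ H}
  {a : ℕ → ℂ} {m : ℕ}

/-- The vector `a 0 • e n + … + a (m - 1) • e (n + m - 1)`, a test vector supported on a block of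
`m` consecutive coordinates. -/
def blockVec (e : HilbertBasis ℕ ℂ H) (a : ℕ → ℂ) (n m : ℕ) : H :=
  ∑ k ∈ range m, a k • e (n + k)

theorem blockVec_succ (e : HilbertBasis ℕ ℂ H) (a : ℕ → ℂ) (n m : ℕ) :
    blockVec e a n (m + 1) = blockVec e a n m + a m • e (n + m) :=
  sum_range_succ _ _

theorem inner_blockVec_basis (e : HilbertBasis ℕ ℂ H) (a : ℕ → ℂ) (n m j : ℕ) :
    inner ℂ (blockVec e a n m) (e (n + j)) = if j < m then conj (a j) else 0 := by
  simp [blockVec, inner_basis]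

theorem inner_basis_blockVec_of_lt (e : HilbertBasis ℕ ℂ H) (a : ℕ → ℂ) {n j : ℕ} (m : ℕ)
    (h : j < n) : inner ℂ (e j) (blockVec e a n m) = 0 := by
  rw [blockVec, inner_sum]
  refine sum_eq_zero fun k _ => ?_
  rw [inner_smul_right, inner_basis, if_neg (by omega), mul_zero]

theorem norm_sq_blockVec (e : HilbertBasis ℕ ℂ H) (a : ℕ → ℂ) (n m : ℕ) :
    ‖blockVec e a n m‖ ^ 2 = ∑ k ∈ range m, ‖a k‖ ^ 2 := by
  have h : (inner ℂ (blockVec e a n m) (blockVec e a n m) : ℂ) =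
      ∑ k ∈ range m, (‖a k‖ : ℂ) ^ 2 := by
    nth_rewrite 2 [blockVec]
    rw [inner_sum]
    refine sum_congr rfl fun k hk => ?_
    rw [inner_smul_right, inner_blockVec_basis, if_pos (mem_range.1 hk), Complex.mul_conj']
  rw [inner_self_eq_norm_sq_to_K] at h
  rw [← Complex.ofReal_inj]
  push_cast
  exact h

theorem norm_blockVec_le {ε : ℝ} (hε : 0 ≤ ε) (ha : ∀ k < m, ‖a k‖ ≤ ε) (n : ℕ) :
    ‖blockVec e a n m‖ ≤ ε * √m := by
  rw [← sq_le_sq₀ (norm_nonneg _) (by positivity), norm_sq_blockVec, mul_pow,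
    Real.sq_sqrt m.cast_nonneg]
  calc ∑ k ∈ range m, ‖a k‖ ^ 2 ≤ ∑ _k ∈ range m, ε ^ 2 := sum_le_sum fun k hk =>
        pow_le_pow_left₀ (norm_nonneg _) (ha k (mem_range.1 hk)) 2
    _ = ε ^ 2 * m := by simp [mul_comm]

theorem sqrt_le_norm_blockVec {p : ℕ} (hpm : p ≤ m) (ha : ∀ k < p, 1 ≤ ‖a k‖) (n : ℕ) :
    √p ≤ ‖blockVec e a n m‖ := by
  refine Real.sqrt_le_iff.2 ⟨norm_nonneg _, ?_⟩
  rw [norm_sq_blockVec]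
  calc (p : ℝ) = ∑ _k ∈ range p, (1 : ℝ) := by simp
    _ ≤ ∑ k ∈ range p, ‖a k‖ ^ 2 :=
      sum_le_sum fun k hk => one_le_pow₀ (ha k (mem_range.1 hk))
    _ ≤ ∑ k ∈ range m, ‖a k‖ ^ 2 :=
      sum_le_sum_of_subset_of_nonneg (range_mono hpm) fun _ _ _ => by positivity

end BlockVec

/-- `T` is the unilateral weighted shift with weights `w` along the orthonormal basis `e`. -/
def IsWeightedShift {H : Type*} [NormedAddCommGroup H] [InnerProductSpace ℂ H]
    (e : HilbertBasis ℕ ℂ H) (w : ℕ → ℝ) (T : H →L[ℂ] H) : Prop :=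
  ∀ n, T (e n) = (w n : ℂ) • e (n + 1)

namespace IsWeightedShift

variable {H : Type*} [NormedAddCommGroup H] [InnerProductSpace ℂ H]
  {e : HilbertBasis ℕ ℂ H} {w : ℕ → ℝ} {T : H →L[ℂ] H} {z : ℂ}

section Form

variable (hT : IsWeightedShift e w T)

include hT

theorem apply_blockVec (a : ℕ → ℂ) (n m : ℕ) :
    T (blockVec e a n m) = blockVec e (fun k => w (n + k) * a k) (n + 1) m := by
  simp only [blockVec, map_sum, map_smul, hT _, smul_smul, mul_comm, add_right_comm]

theorem inner_blockVec (a : ℕ → ℂ) (n m : ℕ) :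
    inner ℂ (blockVec e a n (m + 1)) (T (blockVec e a n (m + 1))) =
      ∑ k ∈ range m, w (n + k) * (a k * conj (a (k + 1))) := by
  rw [hT.apply_blockVec]
  nth_rewrite 2 [blockVec]
  simp only [inner_sum, inner_smul_right, add_assoc, add_comm 1, inner_blockVec_basis]
  rw [sum_range_succ, if_neg (lt_irrefl _), mul_zero, add_zero]
  refine sum_congr rfl fun k hk => ?_
  rw [if_pos (by simpa using hk), mul_assoc]

theorem shifted_blockVec (z : ℂ) (a : ℕ → ℂ) (n m : ℕ) :
    shifted T z (blockVec e a n m) =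
      blockVec e (fun k => w (n + k) * a k - z * a (k + 1)) (n + 1) m +
        z • (a m • e (n + m) - a 0 • e n) := by
  induction m with
  | zero => simp [blockVec]
  | succ m ih =>
    rw [blockVec_succ, map_add, ih, blockVec_succ, map_smul, shifted_apply, hT,
      add_right_comm n 1 m, ← add_assoc n m 1]
    module

theorem norm_shifted_blockVec_le {a : ℕ → ℂ} {n m : ℕ} {ε : ℝ} (hε : 0 ≤ ε)
    (ha : ∀ k < m, ‖w (n + k) * a k - z * a (k + 1)‖ ≤ ε) :
    ‖shifted T z (blockVec e a n m)‖ ≤ ε * √m + ‖z‖ * (‖a m‖ + ‖a 0‖) := by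
  rw [hT.shifted_blockVec]
  refine norm_add_le_of_le (norm_blockVec_le hε ha _) ?_
  rw [norm_smul]
  gcongr
  refine (norm_sub_le _ _).trans_eq ?_
  simp only [norm_smul, norm_basis, mul_one]

end Form

section Adjoint

variable [CompleteSpace H] (hT : IsWeightedShift e w T)

include hT

theorem repr_adjoint (x : H) (n : ℕ) : e.repr (adjoint T x) n = w n * e.repr x (n + 1) := by
  rw [e.repr_apply_apply, e.repr_apply_apply, ContinuousLinearMap.adjoint_inner_right, hT,
    inner_smul_left, Complex.conj_ofReal]

theorem adjoint_basis_succ (n : ℕ) : adjoint T (e (n + 1)) = (w n : ℂ) • e n := by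
  refine eq_of_repr_eq (e := e) fun k => ?_
  rw [hT.repr_adjoint, e.repr_apply_apply, e.repr_apply_apply, inner_smul_right, inner_basis,
    inner_basis]
  by_cases h : k = n <;> simp [h]

theorem adjoint_basis_zero : adjoint T (e 0) = 0 := by
  refine eq_of_repr_eq (e := e) fun k => ?_
  rw [hT.repr_adjoint, e.repr_apply_apply, inner_basis]
  simp

theorem repr_succ (x : H) (n : ℕ) : e.repr (T x) (n + 1) = w n * e.repr x n := by
  rw [e.repr_apply_apply, e.repr_apply_apply, ← ContinuousLinearMap.adjoint_inner_left,
    hT.adjoint_basis_succ, inner_smul_left, Complex.conj_ofReal]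

theorem repr_zero (x : H) : e.repr (T x) 0 = 0 := by
  rw [e.repr_apply_apply, ← ContinuousLinearMap.adjoint_inner_left, hT.adjoint_basis_zero,
    inner_zero_left]

theorem hasSum_norm_sq (x : H) : HasSum (fun n => w n ^ 2 * ‖e.repr x n‖ ^ 2) (‖T x‖ ^ 2) := by
  have h := (hasSum_nat_add_iff' 1).2 (hasSum_norm_sq_repr e (T x))
  simpa [hT.repr_succ, hT.repr_zero, mul_pow] using h

theorem norm_le {R : ℝ} (hw : ∀ n, |w n| ≤ R) : ‖T‖ ≤ R := by
  have hR : 0 ≤ R := (abs_nonneg _).trans (hw 0)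
  refine T.opNorm_le_bound hR fun x => ?_
  rw [← sq_le_sq₀ (norm_nonneg _) (by positivity), mul_pow]
  refine hasSum_le (fun n => ?_) (hT.hasSum_norm_sq x)
    ((hasSum_norm_sq_repr e x).mul_left (R ^ 2))
  have : w n ^ 2 ≤ R ^ 2 := sq_le_sq.2 ((hw n).trans (le_abs_self R))
  gcongr

theorem mul_norm_le_norm_apply {r : ℝ} (hr : 0 ≤ r) (hw : ∀ n, r ≤ |w n|) (x : H) :
    r * ‖x‖ ≤ ‖T x‖ := by
  rw [← sq_le_sq₀ (by positivity) (norm_nonneg _), mul_pow]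
  refine hasSum_le (fun n => ?_) ((hasSum_norm_sq_repr e x).mul_left (r ^ 2))
    (hT.hasSum_norm_sq x)
  have : r ^ 2 ≤ w n ^ 2 := sq_le_sq.2 ((abs_of_nonneg hr).trans_le (hw n))
  gcongr

theorem eq_zero_of_apply_eq_smul (hz : z ≠ 0) {x : H} (hx : T x = z • x) : x = 0 := by
  have hrec : ∀ n, z * e.repr x n = e.repr (T x) n := fun n => by rw [hx]; simp
  refine eq_of_repr_eq (e := e) fun n => ?_
  induction n with
  | zero => simpa [hT.repr_zero, hz] using hrec 0
  | succ n ih => simpa [hT.repr_succ, ih, hz] using hrec (n + 1)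

theorem eq_zero_of_apply_eq_zero (hw : ∀ n, w n ≠ 0) {x : H} (hx : T x = 0) : x = 0 :=
  eq_of_repr_eq (e := e) fun n => by simpa [hx, hw n] using hT.repr_succ x n

theorem notMem_pointSpectrum (h : z ≠ 0 ∨ ∀ n, w n ≠ 0) : z ∉ pointSpectrum T := by
  rw [mem_pointSpectrum_iff_exists]
  rintro ⟨x, hx0, hx⟩
  rcases eq_or_ne z 0 with rfl | hz
  · exact hx0 (hT.eq_zero_of_apply_eq_zero (h.resolve_left (by simp)) (by simpa using hx))
  · exact hx0 (hT.eq_zero_of_apply_eq_smul hz hx)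

end Adjoint

end IsWeightedShift

/-- Arbitrarily far out, `w` has arbitrarily long blocks of weights arbitrarily close to `t`. -/
def HasFlatBlocks (w : ℕ → ℝ) (t : ℝ) : Prop :=
  ∀ m : ℕ, ∀ ε > 0, ∃ᶠ n in atTop, ∀ k < m, |w (n + k) - t| < ε

/-- Arbitrarily far out, `w` has arbitrarily long blocks of weights arbitrarily close to `R`,
followed at once by arbitrarily long blocks of weights arbitrarily close to `r`. -/
def HasStepBlocks (w : ℕ → ℝ) (R r : ℝ) : Prop :=
  ∀ p q : ℕ, ∀ ε > 0, ∃ᶠ n in atTop,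
    (∀ k < p, |w (n + k) - R| < ε) ∧ ∀ k < q, |w (n + p + k) - r| < ε

section Blocks

variable {w : ℕ → ℝ} {r R : ℝ}

theorem HasStepBlocks.hasFlatBlocks_left (h : HasStepBlocks w R r) : HasFlatBlocks w R :=
  fun m ε hε => (h m 0 ε hε).mono fun _ hn => hn.1

theorem HasStepBlocks.hasFlatBlocks_right (h : HasStepBlocks w R r) : HasFlatBlocks w r :=
  fun m ε hε => (h 0 m ε hε).mono fun _ hn => hn.2

theorem HasFlatBlocks.frequently_mul_le_sum (h : HasFlatBlocks w R) {s : ℝ} (hs : s < R) (m : ℕ) :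
    ∃ᶠ n in atTop, m * s ≤ ∑ k ∈ range m, w (n + k) := by
  refine (h m (R - s) (sub_pos.2 hs)).mono fun n hn => ?_
  calc m * s = ∑ _k ∈ range m, s := by simp
    _ ≤ ∑ k ∈ range m, w (n + k) := sum_le_sum fun k hk => by
      linarith [(abs_lt.1 (hn k (mem_range.1 hk))).1]

theorem one_le_norm_prod_div {v : ℕ → ℝ} {z : ℂ} (hz : z ≠ 0) {k : ℕ}
    (hv : ∀ i < k, ‖z‖ ≤ |v i|) : 1 ≤ ‖∏ i ∈ range k, (v i / z : ℂ)‖ := by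
  rw [norm_prod, ← prod_const_one (s := range k)]
  refine prod_le_prod (fun _ _ => zero_le_one) fun i hi => ?_
  rw [norm_div, Complex.norm_real, one_le_div (norm_pos_iff.2 hz)]
  exact hv i (mem_range.1 hi)

theorem norm_prod_div_le_pow {v : ℕ → ℝ} {c : ℝ} {k : ℕ} (hv : ∀ i < k, |v i| ≤ c) (z : ℂ) :
    ‖∏ i ∈ range k, (v i / z : ℂ)‖ ≤ (c / ‖z‖) ^ k := by
  rw [norm_prod]
  calc ∏ i ∈ range k, ‖(v i / z : ℂ)‖ ≤ ∏ _i ∈ range k, c / ‖z‖ := by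
        refine prod_le_prod (fun _ _ => norm_nonneg _) fun i hi => ?_
        rw [norm_div, Complex.norm_real]
        exact div_le_div_of_nonneg_right (hv i (mem_range.1 hi)) (norm_nonneg z)
    _ = (c / ‖z‖) ^ k := by rw [prod_const, card_range]

theorem HasStepBlocks.exists_norm_prod_div (hb : HasStepBlocks w R r)
    (hw : ∀ n, |w n| ≤ R) {z : ℂ} (hr : 0 ≤ r) (hrz : r < ‖z‖) (hzR : ‖z‖ < R) (p : ℕ) :
    ∃ n m, p ≤ m ∧ (∀ k < p, 1 ≤ ‖∏ i ∈ range k, (w (n + i) / z : ℂ)‖) ∧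
      ‖∏ i ∈ range m, (w (n + i) / z : ℂ)‖ ≤ 1 := by
  have hz : 0 < ‖z‖ := hr.trans_lt hrz
  have hRp : 0 < (R / ‖z‖) ^ p := by have := hz.trans hzR; positivity
  obtain ⟨s, hrs, hsz⟩ := exists_between hrz
  obtain ⟨q, hq⟩ : ∃ q : ℕ, (s / ‖z‖) ^ q < ((R / ‖z‖) ^ p)⁻¹ :=
    exists_pow_lt_of_lt_one (inv_pos.2 hRp) ((div_lt_one hz).2 hsz)
  obtain ⟨n, hnp, hnq⟩ := (hb p q (min (R - ‖z‖) (s - r))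
    (lt_min (sub_pos.2 hzR) (sub_pos.2 hrs))).exists
  refine ⟨n, p + q, Nat.le_add_right p q, fun k hk => ?_, ?_⟩
  · refine one_le_norm_prod_div (norm_pos_iff.1 hz) fun i hi => le_abs.2 (Or.inl ?_)
    linarith [(abs_lt.1 (lt_min_iff.1 (hnp i (hi.trans hk))).1).1]
  · have hR := norm_prod_div_le_pow (v := fun i => w (n + i)) (k := p) (fun i _ => hw _) z
    have hs := norm_prod_div_le_pow (v := fun i => w (n + (p + i))) (k := q) (c := s)
      (fun i hi => by
        have := abs_lt.1 (lt_min_iff.1 (hnq i hi)).2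
        rw [← add_assoc]
        exact abs_le.2 ⟨by linarith, by linarith⟩) z
    calc ‖∏ i ∈ range (p + q), (w (n + i) / z : ℂ)‖
        ≤ (R / ‖z‖) ^ p * (s / ‖z‖) ^ q := by
          rw [prod_range_add, norm_mul]
          gcongr
      _ ≤ (R / ‖z‖) ^ p * ((R / ‖z‖) ^ p)⁻¹ := by gcongr
      _ = 1 := mul_inv_cancel₀ hRp.ne'

end Blocks

section QuadraticForm

/-- The coefficients `β, β * conj u, …, β * conj u ^ m, 0, γ` of a test vector for the quadratic
form of a weighted shift: the geometric part gives the form its value, in the direction of `u`,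
while `γ` only adjusts the norm, the `0` keeping it from interacting with the rest. -/
def phaseCoeff (u : ℂ) (β γ : ℝ) (m k : ℕ) : ℂ :=
  if k ≤ m then β * conj u ^ k else if k = m + 1 then 0 else γ

variable {u : ℂ} {β γ : ℝ} {m : ℕ}

theorem phaseCoeff_of_le {k : ℕ} (hk : k ≤ m) : phaseCoeff u β γ m k = β * conj u ^ k :=
  if_pos hk

theorem phaseCoeff_add_one : phaseCoeff u β γ m (m + 1) = 0 := by simp [phaseCoeff]

theorem phaseCoeff_add_two : phaseCoeff u β γ m (m + 2) = γ := by simp [phaseCoeff]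

theorem sum_norm_sq_phaseCoeff (hu : ‖u‖ = 1) :
    ∑ k ∈ range (m + 3), ‖phaseCoeff u β γ m k‖ ^ 2 = (m + 1) * β ^ 2 + γ ^ 2 := by
  have hnorm : ∀ k ∈ range (m + 1), ‖phaseCoeff u β γ m k‖ ^ 2 = β ^ 2 := fun k hk => by
    simp [phaseCoeff_of_le (Nat.lt_succ_iff.1 (mem_range.1 hk)), hu]
  rw [sum_range_succ, sum_range_succ, sum_congr rfl hnorm, phaseCoeff_add_one, phaseCoeff_add_two]
  simp

theorem sum_mul_phaseCoeff (hu : ‖u‖ = 1) (v : ℕ → ℝ) :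
    ∑ k ∈ range (m + 2), v k * (phaseCoeff u β γ m k * conj (phaseCoeff u β γ m (k + 1))) =
      (β ^ 2 * ∑ k ∈ range m, v k : ℝ) * u := by
  have hterm : ∀ k ∈ range m,
      v k * (phaseCoeff u β γ m k * conj (phaseCoeff u β γ m (k + 1))) = v k * (β ^ 2 * u) :=
    fun k hk => by
      have hpow : (conj u ^ k * u ^ k : ℂ) = 1 := by
        rw [← mul_pow, Complex.conj_mul', hu]; simp
      rw [phaseCoeff_of_le (mem_range.1 hk).le, phaseCoeff_of_le (mem_range.1 hk), map_mul,
        map_pow, Complex.conj_conj, Complex.conj_ofReal, pow_succ]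
      linear_combination v k * β ^ 2 * u * hpow
  rw [sum_range_succ, sum_range_succ, sum_congr rfl hterm, phaseCoeff_add_one, ← sum_mul]
  push_cast
  simp only [map_zero, mul_zero, zero_mul, add_zero]
  ring

theorem exists_coeff_sum_eq {v : ℕ → ℝ} {z : ℂ} (h : (m + 1) * ‖z‖ ≤ ∑ k ∈ range m, v k) :
    ∃ a : ℕ → ℂ, ∑ k ∈ range (m + 3), ‖a k‖ ^ 2 = 1 ∧
      ∑ k ∈ range (m + 2), v k * (a k * conj (a (k + 1))) = z := by
  obtain ⟨u, hu, huz⟩ := Complex.exists_norm_mul_eq_self z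
  set S : ℝ := ∑ k ∈ range m, v k
  have hS : 0 ≤ S := le_trans (by positivity) h
  have hS0 : S = 0 → ‖z‖ = 0 := fun h0 => by
    rw [h0] at h
    nlinarith [norm_nonneg z]
  have hm : (m + 1) * (‖z‖ / S) ≤ 1 := by
    rw [← mul_div_assoc]
    exact div_le_one_of_le₀ h hS
  refine ⟨phaseCoeff u √(‖z‖ / S) √(1 - (m + 1) * (‖z‖ / S)) m, ?_, ?_⟩
  · rw [sum_norm_sq_phaseCoeff hu, Real.sq_sqrt (by positivity), Real.sq_sqrt (sub_nonneg.2 hm)]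
    ring
  · rw [sum_mul_phaseCoeff hu, Real.sq_sqrt (by positivity), div_mul_cancel_of_imp hS0, mul_comm,
      huz]

end QuadraticForm

namespace IsWeightedShift

variable {H : Type*} [NormedAddCommGroup H] [InnerProductSpace ℂ H]
  {e : HilbertBasis ℕ ℂ H} {w : ℕ → ℝ} {T : H →L[ℂ] H} {z : ℂ} {r R : ℝ}
  (hT : IsWeightedShift e w T)

include hT

theorem mem_approxPointSpectrum_of_hasFlatBlocks (hw : HasFlatBlocks w ‖z‖) :
    z ∈ approxPointSpectrum T := by
  refine mem_approxPointSpectrum_of_forall_exists_lt fun c hc => ?_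
  obtain ⟨u, hu, huz⟩ := Complex.exists_norm_mul_eq_self z
  obtain ⟨m, hm⟩ := exists_nat_gt ((4 * ‖z‖ / c) ^ 2)
  obtain ⟨n, hn⟩ := (hw m (c / 2) (by positivity)).exists
  set a : ℕ → ℂ := fun k => conj u ^ k
  have ha : ∀ k, ‖a k‖ = 1 := fun k => by simp [a, hu]
  have hstep : ∀ k, z * a (k + 1) = ‖z‖ * a k := fun k => by
    have huu : u * conj u = 1 := by rw [Complex.mul_conj', hu]; simp
    calc z * a (k + 1) = ‖z‖ * a k * (u * conj u) := by
          nth_rewrite 1 [← huz]; simp only [a, pow_succ]; ring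
      _ = ‖z‖ * a k := by rw [huu, mul_one]
  have hdefect : ∀ k < m, ‖w (n + k) * a k - z * a (k + 1)‖ ≤ c / 2 := fun k hk => by
    rw [hstep, ← sub_mul, norm_mul, ha, mul_one, ← Complex.ofReal_sub, Complex.norm_real]
    exact (hn k hk).le
  refine ⟨blockVec e a n m, ?_⟩
  have hm' : 4 * ‖z‖ < √m * c := (div_lt_iff₀ hc).1 (Real.lt_sqrt_of_sq_lt hm)
  calc ‖shifted T z (blockVec e a n m)‖ ≤ c / 2 * √m + ‖z‖ * (‖a m‖ + ‖a 0‖) :=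
        hT.norm_shifted_blockVec_le (by positivity) hdefect
    _ < c * √m := by rw [ha, ha]; linarith
    _ ≤ c * ‖blockVec e a n m‖ := by
      gcongr
      exact sqrt_le_norm_blockVec le_rfl (fun k _ => (ha k).ge) n

theorem mem_approxPointSpectrum_of_hasStepBlocks (hw : ∀ n, |w n| ≤ R)
    (hb : HasStepBlocks w R r) (hr : 0 ≤ r) (hrz : r < ‖z‖) (hzR : ‖z‖ < R) :
    z ∈ approxPointSpectrum T := by
  refine mem_approxPointSpectrum_of_forall_exists_lt fun c hc => ?_
  have hz : z ≠ 0 := norm_pos_iff.1 (hr.trans_lt hrz)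
  obtain ⟨p, hp⟩ := exists_nat_gt ((2 * ‖z‖ / c) ^ 2)
  obtain ⟨n, m, hpm, hlow, hend⟩ := hb.exists_norm_prod_div hw hr hrz hzR p
  set a : ℕ → ℂ := fun k => ∏ i ∈ range k, (w (n + i) / z : ℂ)
  -- `a` solves the eigenvalue equation along the block, so only its two ends contribute.
  have hdefect : ∀ k, w (n + k) * a k - z * a (k + 1) = 0 := fun k => by
    simp only [a, prod_range_succ]
    field_simp
    ring
  refine ⟨blockVec e a n m, ?_⟩
  have hp' : 2 * ‖z‖ < √p * c := (div_lt_iff₀ hc).1 (Real.lt_sqrt_of_sq_lt hp)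
  calc ‖shifted T z (blockVec e a n m)‖ ≤ 0 * √m + ‖z‖ * (‖a m‖ + ‖a 0‖) :=
        hT.norm_shifted_blockVec_le le_rfl fun k _ => by rw [hdefect, norm_zero]
    _ ≤ ‖z‖ * (1 + 1) := by
      rw [zero_mul, zero_add]
      gcongr
      simp [a]
    _ < c * √p := by linarith
    _ ≤ c * ‖blockVec e a n m‖ := by
      gcongr
      exact sqrt_le_norm_blockVec hpm hlow n

theorem exists_norm_eq_one_inner_eq (hb : HasFlatBlocks w R) (hz : ‖z‖ < R) (N : ℕ) :
    ∃ x : H, ‖x‖ = 1 ∧ inner ℂ x (T x) = z ∧ ∀ k < N, inner ℂ (e k) x = 0 := by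
  obtain ⟨s, hzs, hsR⟩ := exists_between hz
  obtain ⟨m, hm⟩ := exists_nat_gt (‖z‖ / (s - ‖z‖))
  obtain ⟨n, hnN, hn⟩ := (hb.frequently_mul_le_sum hsR m).forall_exists_of_atTop N
  rw [div_lt_iff₀ (sub_pos.2 hzs)] at hm
  obtain ⟨a, ha, haz⟩ := exists_coeff_sum_eq (v := fun k => w (n + k)) (m := m) (z := z)
    (by linarith)
  refine ⟨blockVec e a n (m + 3), ?_, ?_, fun k hk => ?_⟩
  · rw [← pow_eq_one_iff_of_nonneg (norm_nonneg _) two_ne_zero, norm_sq_blockVec, ha]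
  · rw [hT.inner_blockVec, haz]
  · exact inner_basis_blockVec_of_lt e a _ (hk.trans_le hnN)

end IsWeightedShift

section SumSqProd

/-- The series `∑ ((t / x 0) ⋯ (t / x (n - 1))) ^ 2`. For `t = ‖z‖` it is the squared norm of the
formal eigenvector, with first coordinate `1` and eigenvalue `z`, of the adjoint of the shift with
weights `x`. -/
def sumSqProd (t : ℝ) (x : ℕ → ℝ) : ℝ≥0∞ :=
  ∑' n, ENNReal.ofReal ((∏ i ∈ range n, t / x i) ^ 2)

variable {t : ℝ} {x : ℕ → ℝ}

theorem sumSqProd_ne_top_iff :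
    sumSqProd t x ≠ ∞ ↔ Summable fun n => (∏ i ∈ range n, t / x i) ^ 2 := by
  refine ⟨fun h => ?_, Summable.tsum_ofReal_ne_top⟩
  simpa only [ENNReal.toReal_ofReal (sq_nonneg _)] using ENNReal.summable_toReal h

theorem sumSqProd_zero (x : ℕ → ℝ) : sumSqProd 0 x = 1 := by
  rw [sumSqProd, tsum_eq_single 0 fun n hn => by simp [hn]]
  simp

theorem sumSqProd_mono {s : ℝ} (hs : 0 ≤ s) (hst : s ≤ t) (x : ℕ → ℝ) :
    sumSqProd s x ≤ sumSqProd t x := by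
  refine ENNReal.tsum_le_tsum fun n => ENNReal.ofReal_le_ofReal (sq_le_sq.2 ?_)
  simp only [prod_div_distrib, prod_const, card_range, abs_div, abs_pow]
  gcongr

theorem sumSqProd_eq_one_add (t : ℝ) (x : ℕ → ℝ) :
    sumSqProd t x =
      1 + sumSqProd t (fun n => x (n + 1)) * ENNReal.ofReal ((t / x 0) ^ 2) := by
  rw [sumSqProd, tsum_eq_zero_add' ENNReal.summable, sumSqProd, ← ENNReal.tsum_mul_right]
  simp only [prod_range_zero, one_pow, ENNReal.ofReal_one, prod_range_succ', mul_pow,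
    ENNReal.ofReal_mul (sq_nonneg _)]

theorem sumSqProd_ne_top_of_lt {c : ℝ} (ht : 0 ≤ t) (htc : t < c) (hx : ∀ n, c ≤ |x n|) :
    sumSqProd t x ≠ ∞ := by
  have hc : 0 < c := ht.trans_lt htc
  refine sumSqProd_ne_top_iff.2 <| Summable.of_nonneg_of_le (fun n => sq_nonneg _) (fun n => ?_)
    (summable_geometric_of_lt_one (sq_nonneg (t / c))
      (pow_lt_one₀ (by positivity) ((div_lt_one hc).2 htc) two_ne_zero))
  calc (∏ i ∈ range n, t / x i) ^ 2 = ∏ i ∈ range n, (t / |x i|) ^ 2 := by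
        simp only [← prod_pow, div_pow, sq_abs]
    _ ≤ ∏ _i ∈ range n, (t / c) ^ 2 := by
        gcongr with i
        exact hx i
    _ = ((t / c) ^ 2) ^ n := by rw [prod_const, card_range]

end SumSqProd

namespace IsWeightedShift

variable {H : Type*} [NormedAddCommGroup H] [InnerProductSpace ℂ H] [CompleteSpace H]
  {e : HilbertBasis ℕ ℂ H} {w : ℕ → ℝ} {T : H →L[ℂ] H} {z : ℂ} {r R : ℝ}
  (hT : IsWeightedShift e w T)

include hT

section AdjointKernel

theorem mem_ker_shifted_adjoint_iff {x : H} :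
    x ∈ (shifted (adjoint T) z).ker ↔ ∀ n, w n * e.repr x (n + 1) = z * e.repr x n := by
  rw [LinearMap.mem_ker, ContinuousLinearMap.coe_coe, shifted_apply, sub_eq_zero]
  refine ⟨fun h n => ?_, fun h => eq_of_repr_eq (e := e) fun n => ?_⟩
  · rw [← hT.repr_adjoint, h, map_smul]
    rfl
  · rw [hT.repr_adjoint, h, map_smul]
    rfl

theorem repr_of_mem_ker_shifted_adjoint (hw : ∀ n, w n ≠ 0) {x : H}
    (hx : x ∈ (shifted (adjoint T) z).ker) (n : ℕ) :
    e.repr x n = (∏ i ∈ range n, z / w i) * e.repr x 0 := by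
  induction n with
  | zero => simp
  | succ n ih =>
    have hn : (w n : ℂ) ≠ 0 := Complex.ofReal_ne_zero.2 (hw n)
    rw [prod_range_succ, mul_right_comm, ← ih, mul_div_assoc', eq_div_iff hn, mul_comm,
      hT.mem_ker_shifted_adjoint_iff.1 hx n, mul_comm]

theorem repr_zero_ne_zero_of_mem_ker_shifted_adjoint (hw : ∀ n, w n ≠ 0) {x : H}
    (hx : x ∈ (shifted (adjoint T) z).ker) (hx0 : x ≠ 0) : e.repr x 0 ≠ 0 := fun h =>
  hx0 <| eq_of_repr_eq (e := e) fun n => by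
    rw [hT.repr_of_mem_ker_shifted_adjoint hw hx n, h, mul_zero, map_zero]
    rfl

theorem pointSpectrum_adjoint (hw : ∀ n, w n ≠ 0) :
    pointSpectrum (adjoint T) = {z | sumSqProd ‖z‖ w ≠ ∞} := by
  ext z
  have hprod : ∀ n, ‖∏ i ∈ range n, (z / w i : ℂ)‖ ^ 2 = (∏ i ∈ range n, ‖z‖ / w i) ^ 2 :=
    fun n => by simp [norm_prod, ← prod_pow, div_pow, sq_abs]
  rw [mem_pointSpectrum_iff_ker_ne_bot, Submodule.ne_bot_iff, Set.mem_ofPred_eq,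
    sumSqProd_ne_top_iff]
  constructor
  · rintro ⟨x, hx, hx0⟩
    have h0 := hT.repr_zero_ne_zero_of_mem_ker_shifted_adjoint hw hx hx0
    have hcoord : ∀ n, ‖e.repr x n‖ ^ 2 =
        (∏ i ∈ range n, ‖z‖ / w i) ^ 2 * ‖e.repr x 0‖ ^ 2 := fun n => by
      rw [hT.repr_of_mem_ker_shifted_adjoint hw hx n, norm_mul, mul_pow, hprod]
    exact (summable_mul_right_iff (pow_ne_zero 2 (norm_ne_zero_iff.2 h0))).1 <|
      (summable_congr hcoord).1 (hasSum_norm_sq_repr e x).summable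
  · intro hsum
    let f : lp (fun _ : ℕ => ℂ) 2 := ⟨fun n => ∏ i ∈ range n, (z / w i : ℂ), memℓp_gen <| by
      simpa only [ENNReal.toReal_ofNat, Real.rpow_ofNat, hprod] using hsum⟩
    have hf : ∀ n, e.repr (e.repr.symm f) n = ∏ i ∈ range n, (z / w i : ℂ) := fun n => by
      rw [e.repr.apply_symm_apply]
    refine ⟨e.repr.symm f, hT.mem_ker_shifted_adjoint_iff.2 fun n => ?_, fun h => ?_⟩
    · have hn : (w n : ℂ) ≠ 0 := Complex.ofReal_ne_zero.2 (hw n)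
      rw [hf, hf, prod_range_succ]
      field_simp
    · have h0 := hf 0
      rw [h, map_zero, prod_range_zero] at h0
      exact zero_ne_one h0

theorem finrank_ker_shifted_adjoint (hw : ∀ n, w n ≠ 0) (hz : z ∈ pointSpectrum (adjoint T)) :
    Module.finrank ℂ (shifted (adjoint T) z).ker = 1 := by
  obtain ⟨x, hx, hx0⟩ := (Submodule.ne_bot_iff _).1 (mem_pointSpectrum_iff_ker_ne_bot.1 hz)
  have h0 := hT.repr_zero_ne_zero_of_mem_ker_shifted_adjoint hw hx hx0
  refine (finrank_eq_one_iff_of_nonzero' (⟨x, hx⟩ : (shifted (adjoint T) z).ker)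
    fun h => hx0 (congrArg Subtype.val h)).2 fun y => ?_
  refine ⟨e.repr y 0 / e.repr x 0, Subtype.ext <| eq_of_repr_eq (e := e) fun n => ?_⟩
  simp only [SetLike.val_smul, map_smul, lp.coeFn_smul, Pi.smul_apply, smul_eq_mul]
  rw [hT.repr_of_mem_ker_shifted_adjoint hw hx n, hT.repr_of_mem_ker_shifted_adjoint hw y.2 n]
  field_simp

end AdjointKernel

section FrequentlyZero

variable (hw : ∃ᶠ n in atTop, w n = 0)

include hw

theorem pointSpectrum_of_frequently_zero : pointSpectrum T = {0} := by
  refine Set.eq_singleton_iff_unique_mem.2 ⟨?_, fun z hz => ?_⟩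
  · obtain ⟨n, hn⟩ := hw.exists
    exact mem_pointSpectrum_iff_exists.2 ⟨e n, e.orthonormal.ne_zero n, by simp [hT n, hn]⟩
  · by_contra h
    exact hT.notMem_pointSpectrum (Or.inl h) hz

theorem pointSpectrum_adjoint_of_frequently_zero : pointSpectrum (adjoint T) = {0} := by
  refine Set.eq_singleton_iff_unique_mem.2 ⟨mem_pointSpectrum_iff_exists.2
    ⟨e 0, e.orthonormal.ne_zero 0, by rw [hT.adjoint_basis_zero, zero_smul]⟩, fun z hz => ?_⟩
  obtain ⟨x, hx, hx0⟩ := (Submodule.ne_bot_iff _).1 (mem_pointSpectrum_iff_ker_ne_bot.1 hz)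
  by_contra h
  have hrec := hT.mem_ker_shifted_adjoint_iff.1 hx
  refine hx0 (eq_of_repr_eq (e := e) fun n => ?_)
  rw [map_zero, lp.coeFn_zero, Pi.zero_apply]
  obtain ⟨m, hnm, hm⟩ := (frequently_atTop.1 hw) n
  induction hnm using Nat.decreasingInduction with
  | self => simpa [hm, h] using hrec m
  | of_succ k _ ih => simpa [ih, h] using hrec k

omit [CompleteSpace H] in
theorem not_finiteDimensional_ker : ¬ FiniteDimensional ℂ T.ker := by
  refine not_finiteDimensional_of_forall_basis_mem (e := e)
    (Nat.nth_injective (Nat.frequently_atTop_iff_infinite.1 hw)) fun n => ?_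
  have hn := Nat.nth_mem_of_infinite (Nat.frequently_atTop_iff_infinite.1 hw) n
  simp [hT _, hn]

theorem not_finiteDimensional_ker_adjoint : ¬ FiniteDimensional ℂ (adjoint T).ker := by
  refine not_finiteDimensional_of_forall_basis_mem (e := e) ((add_left_injective 1).comp
    (Nat.nth_injective (Nat.frequently_atTop_iff_infinite.1 hw))) fun n => ?_
  have hn := Nat.nth_mem_of_infinite (Nat.frequently_atTop_iff_infinite.1 hw) n
  simp [hT.adjoint_basis_succ, hn]

end FrequentlyZero

section InnerDisc

variable (hge : ∀ n, r ≤ |w n|) (hz : ‖z‖ < r)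

include hge hz

theorem notMem_approxPointSpectrum_of_norm_lt : z ∉ approxPointSpectrum T := fun h => by
  refine h ⟨r - ‖z‖, sub_pos.2 hz, fun x => ?_⟩
  calc (r - ‖z‖) * ‖x‖ = r * ‖x‖ - ‖z • x‖ := by rw [norm_smul, sub_mul]
    _ ≤ ‖T x‖ - ‖z • x‖ := by
        gcongr
        exact hT.mul_norm_le_norm_apply ((norm_nonneg z).trans hz.le) hge x
    _ ≤ ‖shifted T z x‖ := norm_sub_norm_le _ _

theorem finrank_ker_adjoint_shifted : Module.finrank ℂ (adjoint (shifted T z)).ker = 1 := by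
  have hw : ∀ n, w n ≠ 0 := fun n => abs_pos.1 (((norm_nonneg z).trans_lt hz).trans_le (hge n))
  rw [adjoint_shifted]
  refine hT.finrank_ker_shifted_adjoint hw ?_
  rw [hT.pointSpectrum_adjoint hw, Set.mem_ofPred_eq, RCLike.norm_conj]
  exact sumSqProd_ne_top_of_lt (norm_nonneg z) hz hge

theorem isFredholm_shifted : (shifted T z).IsFredholm := by
  obtain ⟨K, hK⟩ := notMem_approxPointSpectrum_iff.1
    (hT.notMem_approxPointSpectrum_of_norm_lt hge hz)
  have : FiniteDimensional ℂ (adjoint (shifted T z)).ker :=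
    Module.finite_of_finrank_pos (by rw [hT.finrank_ker_adjoint_shifted hge hz]; exact one_pos)
  have hclosed := hK.isClosed_range (shifted T z).uniformContinuous
  exact isFredholm_of_antilipschitz hK (cokerEquivKerAdjoint _ hclosed).symm.finiteDimensional

theorem index_shifted : index (shifted T z) = -1 := by
  obtain ⟨K, hK⟩ := notMem_approxPointSpectrum_iff.1
    (hT.notMem_approxPointSpectrum_of_norm_lt hge hz)
  rw [index_of_antilipschitz hK, hT.finrank_ker_adjoint_shifted hge hz, Nat.cast_one]

theorem mem_approxDefectSpectrum_of_norm_lt : z ∈ approxDefectSpectrum T := fun hs => by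
  have hindex := hT.index_shifted hge hz
  rw [index, LinearMap.range_eq_top.2 hs,
    Module.finrank_zero_of_subsingleton (M := H ⧸ (⊤ : Submodule ℂ H))] at hindex
  omega

end InnerDisc

section SpectralParts

theorem approxPointSpectrum_subset_wolfSpectrum
    (hzero : (∀ n, w n ≠ 0) ∨ ∃ᶠ n in atTop, w n = 0) : approxPointSpectrum T ⊆ wolfSpectrum T := by
  intro z hz
  by_cases h : z ≠ 0 ∨ ∀ n, w n ≠ 0
  · exact mem_wolfSpectrum_of_injective hz
      (notMem_pointSpectrum_iff_injective.1 (hT.notMem_pointSpectrum h))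
  · push Not at h
    obtain ⟨rfl, n, hn⟩ := h
    have hfreq := hzero.resolve_left fun h => h n hn
    have h0 : shifted T 0 = T := by simp [shifted]
    rw [wolfSpectrum, Set.mem_ofPred_eq, h0]
    exact not_isSemiFredholm_of_ker (hT.not_finiteDimensional_ker hfreq)
      (hT.not_finiteDimensional_ker_adjoint hfreq)

variable (hr : 0 ≤ r) (hge : ∀ n, r ≤ |w n|) (hle : ∀ n, |w n| ≤ R) (hb : HasStepBlocks w R r)

include hle

theorem spectrum_subset_closedBall : spectrum ℂ T ⊆ Metric.closedBall 0 R :=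
  have := nontrivial_of_ne _ _ (e.orthonormal.ne_zero 0)
  (spectrum.subset_closedBall_norm T).trans (Metric.closedBall_subset_closedBall (hT.norm_le hle))

include hr hge hb

theorem approxPointSpectrum_eq : approxPointSpectrum T = {z : ℂ | r ≤ ‖z‖ ∧ ‖z‖ ≤ R} := by
  refine Set.Subset.antisymm (fun z hz => ⟨?_, ?_⟩) fun z ⟨hrz, hzR⟩ => ?_
  · by_contra! h
    exact hT.notMem_approxPointSpectrum_of_norm_lt hge h hz
  · exact mem_closedBall_zero_iff.1
      (hT.spectrum_subset_closedBall hle (approxPointSpectrum_subset_spectrum T hz))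
  · rcases hrz.eq_or_lt with rfl | hrz
    · exact hT.mem_approxPointSpectrum_of_hasFlatBlocks hb.hasFlatBlocks_right
    rcases hzR.eq_or_lt with rfl | hzR
    · exact hT.mem_approxPointSpectrum_of_hasFlatBlocks hb.hasFlatBlocks_left
    exact hT.mem_approxPointSpectrum_of_hasStepBlocks hle hb hr hrz hzR

variable (hzero : (∀ n, w n ≠ 0) ∨ ∃ᶠ n in atTop, w n = 0)

include hzero

theorem essSpectrum_eq : essSpectrum T = {z : ℂ | r ≤ ‖z‖ ∧ ‖z‖ ≤ R} := by
  refine Set.Subset.antisymm (fun z hz => ⟨?_, ?_⟩) ?_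
  · by_contra! h
    exact hz (hT.isFredholm_shifted hge h)
  · exact mem_closedBall_zero_iff.1
      (hT.spectrum_subset_closedBall hle (essSpectrum_subset_spectrum T hz))
  · rw [← hT.approxPointSpectrum_eq hr hge hle hb]
    exact (hT.approxPointSpectrum_subset_wolfSpectrum hzero).trans
      (wolfSpectrum_subset_essSpectrum T)

theorem wolfSpectrum_eq : wolfSpectrum T = {z : ℂ | r ≤ ‖z‖ ∧ ‖z‖ ≤ R} := by
  refine Set.Subset.antisymm ?_ ?_
  · rw [← hT.essSpectrum_eq hr hge hle hb hzero]
    exact wolfSpectrum_subset_essSpectrum T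
  · rw [← hT.approxPointSpectrum_eq hr hge hle hb]
    exact hT.approxPointSpectrum_subset_wolfSpectrum hzero

theorem approxDefectSpectrum_eq : approxDefectSpectrum T = Metric.closedBall 0 R := by
  refine ((approxDefectSpectrum_subset_spectrum T).trans
    (hT.spectrum_subset_closedBall hle)).antisymm fun z hz => ?_
  rcases lt_or_ge ‖z‖ r with h | h
  · exact hT.mem_approxDefectSpectrum_of_norm_lt hge h
  · refine wolfSpectrum_subset_approxDefectSpectrum T ?_
    rw [hT.wolfSpectrum_eq hr hge hle hb hzero]
    exact ⟨h, mem_closedBall_zero_iff.1 hz⟩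

theorem spectrum_eq : spectrum ℂ T = Metric.closedBall 0 R :=
  (hT.spectrum_subset_closedBall hle).antisymm <|
    hT.approxDefectSpectrum_eq hr hge hle hb hzero ▸ approxDefectSpectrum_subset_spectrum T

end SpectralParts

section NumericalRange

variable (hR : 0 < R) (hb : HasFlatBlocks w R)

include hR hb

theorem closedBall_subset_essNumericalRange : Metric.closedBall 0 R ⊆ essNumericalRange T := by
  rw [← closure_ball (0 : ℂ) hR.ne']
  refine closure_minimal (fun z hz => ?_) (isClosed_essNumericalRange T)
  choose x hx hxz hsupp using
    hT.exists_norm_eq_one_inner_eq hb (mem_ball_zero_iff.1 hz)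
  exact mem_essNumericalRange_of_weaklyNull hx (tendsto_inner_zero_of_support hx hsupp) hxz

variable (hle : ∀ n, |w n| ≤ R)

include hle

theorem essNorm_eq : essNorm T = R := by
  refine ((essNorm_le_norm T).trans (hT.norm_le hle)).antisymm ?_
  have hnorm : ‖(R : ℂ)‖ = R := by rw [Complex.norm_real, Real.norm_of_nonneg hR.le]
  exact hnorm.ge.trans <| norm_le_essNorm_of_mem_essNumericalRange <|
    hT.closedBall_subset_essNumericalRange hR hb (mem_closedBall_zero_iff.2 hnorm.le)

theorem norm_eq : ‖T‖ = R :=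
  (hT.norm_le hle).antisymm (hT.essNorm_eq hR hb hle ▸ essNorm_le_norm T)

theorem numericalRange_eq : numericalRange T = Metric.ball 0 R := by
  have hnorm := hT.norm_eq hR hb hle
  refine Set.Subset.antisymm ?_ fun z hz => ?_
  · rintro z ⟨x, hx, rfl⟩
    refine mem_ball_zero_iff.2 (lt_of_le_of_ne ?_ fun h => ?_)
    · simpa [hx, hnorm] using (norm_inner_le_norm (𝕜 := ℂ) x (T x)).trans
        (mul_le_mul_of_nonneg_left (T.le_opNorm x) (norm_nonneg x))
    · obtain ⟨c, hc, hcx⟩ := exists_eq_smul_of_norm_inner_eq hx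
        (norm_pos_iff.1 (hnorm ▸ hR)) (h.trans hnorm.symm)
      simp [hT.eq_zero_of_apply_eq_smul hc hcx] at hx
  · obtain ⟨x, hx, hxz, -⟩ :=
      hT.exists_norm_eq_one_inner_eq hb (mem_ball_zero_iff.1 hz) 0
    exact ⟨x, hx, hxz.symm⟩

theorem essNumericalRange_eq : essNumericalRange T = Metric.closedBall 0 R := by
  refine Set.Subset.antisymm ?_ (hT.closedBall_subset_essNumericalRange hR hb)
  rw [← closure_ball (0 : ℂ) hR.ne', ← hT.numericalRange_eq hR hb hle]
  exact essNumericalRange_subset_closure_numericalRange T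

end NumericalRange

end IsWeightedShift

/-! ### Independent identically distributed weights -/

section EssentialRange

variable {Ω : Type*} [MeasurableSpace Ω] {P : Measure Ω} {Y : Ω → ℝ}

theorem ae_mem_essRan (hY : Measurable Y) : ∀ᵐ ω ∂P, Y ω ∈ essRan P Y := by
  refine ae_of_ae_map hY.aemeasurable ?_
  filter_upwards [Measure.support_mem_ae (μ := P.map Y)] with t ht ε hε
  have hball := (Measure.mem_support_iff_forall t).1 ht _ (Metric.ball_mem_nhds t hε)
  rwa [Measure.map_apply hY measurableSet_ball] at hball

theorem essRan_nonneg (hY : ∀ᵐ ω ∂P, 0 ≤ Y ω) {t : ℝ} (ht : t ∈ essRan P Y) : 0 ≤ t := by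
  by_contra! h
  refine (ht (-t) (neg_pos.2 h)).ne' (measure_mono_null (fun ω hω => ?_) hY)
  have hYt := (abs_lt.1 (show |Y ω - t| < -t from hω)).2
  exact not_le.2 (show Y ω < 0 by linarith)

theorem ae_forall_mem_Icc {X : ℕ → Ω → ℝ} (hmeas : Measurable (X 0))
    (hident : ∀ n, IdentDistrib (X n) (X 0) P P) {r R : ℝ} (hr : IsLeast (essRan P (X 0)) r)
    (hR : IsGreatest (essRan P (X 0)) R) : ∀ᵐ ω ∂P, ∀ n, X n ω ∈ Set.Icc r R :=
  ae_all_iff.2 fun n => (hident n).symm.ae_mem_snd measurableSet_Icc <|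
    (ae_mem_essRan hmeas).mono fun _ hω => ⟨hr.2 hω, hR.2 hω⟩

theorem ae_forall_ne_zero {X : ℕ → Ω → ℝ} (hident : ∀ n, IdentDistrib (X n) (X 0) P P)
    (h0 : P {ω | X 0 ω = 0} = 0) : ∀ᵐ ω ∂P, ∀ n, X n ω ≠ 0 :=
  ae_all_iff.2 fun n => (hident n).symm.ae_mem_snd (t := {0}ᶜ) (measurableSet_singleton 0).compl
    (measure_eq_zero_iff_ae_notMem.1 h0)

end EssentialRange

section Recurrence

variable {Ω β : Type*} [MeasurableSpace Ω] [MeasurableSpace β] {P : Measure Ω}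

theorem iIndepSet_biInter_preimage {ι κ : Type*} {X : ι → Ω → β} (hmeas : ∀ i, Measurable (X i))
    (hindep : iIndepFun X P) {I : κ → Finset ι} (hI : Pairwise (Function.onFun Disjoint I))
    {B : ι → Set β} (hB : ∀ i, MeasurableSet (B i)) :
    iIndepSet (fun j => ⋂ i ∈ I j, X i ⁻¹' B i) P := by
  classical
  refine (iIndepSet_iff_meas_biInter fun j =>
    Finset.measurableSet_biInter _ fun i _ => hmeas i (hB i)).2 fun s => ?_
  rw [← Finset.set_biInter_biUnion, hindep.measure_inter_preimage_eq_mul _ fun i _ => hB i,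
    Finset.prod_biUnion fun _ _ _ _ hab => hI hab]
  exact prod_congr rfl fun j _ => (hindep.measure_inter_preimage_eq_mul _ fun i _ => hB i).symm

variable {X : ℕ → Ω → β} (hmeas : ∀ n, Measurable (X n)) (hindep : iIndepFun X P)
  (hident : ∀ n, IdentDistrib (X n) (X 0) P P)

include hmeas hindep hident

theorem ae_frequently_forall_mem (m : ℕ) {B : ℕ → Set β} (hB : ∀ k, MeasurableSet (B k))
    (hpos : ∀ k < m, P (X 0 ⁻¹' B k) ≠ 0) :
    ∀ᵐ ω ∂P, ∃ᶠ n in atTop, ∀ k < m, X (n + k) ω ∈ B k := by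
  -- Disjoint windows `[j (m + 1), j (m + 1) + m)`; the position inside a window is `i % (m + 1)`.
  let I : ℕ → Finset ℕ := fun j => Finset.Ico (j * (m + 1)) (j * (m + 1) + m)
  let E : ℕ → Set Ω := fun j => ⋂ i ∈ I j, X i ⁻¹' B (i % (m + 1))
  have hmod : ∀ j, ∀ k < m, (j * (m + 1) + k) % (m + 1) = k := fun j k hk => by
    rw [Nat.mul_add_mod_self_right, Nat.mod_eq_of_lt (hk.trans m.lt_succ_self)]
  have hdisj : Pairwise (Function.onFun Disjoint I) := fun a b hab =>
    Finset.disjoint_left.2 fun i ha hb => hab <| by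
      have hdiv : ∀ j, i ∈ I j → i / (m + 1) = j := fun j hj =>
        Nat.div_eq_of_lt_le (Finset.mem_Ico.1 hj).1 (by grind)
      rw [← hdiv a ha, ← hdiv b hb]
  have hPE : ∀ j, P (E j) = ∏ k ∈ range m, P (X 0 ⁻¹' B k) := fun j => by
    rw [hindep.measure_inter_preimage_eq_mul _ fun i _ => hB _, Finset.prod_Ico_eq_prod_range,
      Nat.add_sub_cancel_left]
    refine prod_congr rfl fun k hk => ?_
    rw [hmod j k (mem_range.1 hk)]
    exact (hident _).measure_mem_eq (hB k)
  have hsum : ∑' j, P (E j) = ∞ := by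
    simp only [hPE]
    exact ENNReal.tsum_const_eq_top_of_ne_zero
      (prod_ne_zero_iff.2 fun k hk => hpos k (mem_range.1 hk))
  have hE : ∀ j, MeasurableSet (E j) := fun j =>
    Finset.measurableSet_biInter _ fun i _ => hmeas i (hB _)
  have := hindep.isProbabilityMeasure
  have hlim : ∀ᵐ ω ∂P, ω ∈ limsup E atTop :=
    (prob_compl_eq_zero_iff (MeasurableSet.measurableSet_limsup hE)).2 <|
      measure_limsup_eq_one hE
        (iIndepSet_biInter_preimage hmeas hindep hdisj fun i => hB (i % (m + 1))) hsum
  filter_upwards [hlim] with ω hω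
  refine (tendsto_id.atTop_mul_const' m.succ_pos).frequently
    ((mem_limsup_iff_frequently_mem.1 hω).mono fun j hj k hk => ?_)
  have hmem := Set.mem_iInter₂.1 hj (j * (m + 1) + k) (Finset.mem_Ico.2 (by omega))
  rwa [Set.mem_preimage, hmod j k hk] at hmem

theorem ae_frequently_mem {B : Set β} (hB : MeasurableSet B) (hpos : P (X 0 ⁻¹' B) ≠ 0) :
    ∀ᵐ ω ∂P, ∃ᶠ n in atTop, X n ω ∈ B :=
  (ae_frequently_forall_mem hmeas hindep hident 1 (fun _ => hB) fun _ _ => hpos).mono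
    fun _ hω => hω.mono fun _ h => h 0 one_pos

end Recurrence

theorem ae_hasStepBlocks {Ω : Type*} [MeasurableSpace Ω] {P : Measure Ω} {X : ℕ → Ω → ℝ}
    (hmeas : ∀ n, Measurable (X n)) (hindep : iIndepFun X P)
    (hident : ∀ n, IdentDistrib (X n) (X 0) P P) {r R : ℝ} (hr : r ∈ essRan P (X 0))
    (hR : R ∈ essRan P (X 0)) : ∀ᵐ ω ∂P, HasStepBlocks (fun n => X n ω) R r := by
  have hpattern : ∀ p q j : ℕ, ∀ᵐ ω ∂P, ∃ᶠ n in atTop, ∀ k < p + q, X (n + k) ω ∈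
      Metric.ball (if k < p then R else r) (1 / ((j : ℝ) + 1)) := fun p q j => by
    refine ae_frequently_forall_mem hmeas hindep hident _ (fun _ => measurableSet_ball)
      fun k _ => ?_
    split_ifs
    · exact (hR _ Nat.one_div_pos_of_nat).ne'
    · exact (hr _ Nat.one_div_pos_of_nat).ne'
  filter_upwards [ae_all_iff.2 fun p => ae_all_iff.2 fun q => ae_all_iff.2 (hpattern p q)]
    with ω hω p q ε hε
  obtain ⟨j, hj⟩ := exists_nat_one_div_lt hε
  refine (hω p q j).mono fun n hn => ⟨fun k hk => ?_, fun k hk => ?_⟩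
  · have hball := hn k (by omega)
    rw [if_pos hk] at hball
    exact (Metric.mem_ball.1 hball).trans hj
  · have hball := hn (p + k) (by omega)
    rw [if_neg (by omega), ← add_assoc] at hball
    exact (Metric.mem_ball.1 hball).trans hj

section GeometricMean

variable {Ω : Type*} [MeasurableSpace Ω] {P : Measure Ω} {Y : Ω → ℝ}

theorem lintegral_ofReal_log_ne_top [IsFiniteMeasure P] {C : ℝ} (hY0 : ∀ᵐ ω ∂P, 0 ≤ Y ω)
    (hYC : ∀ᵐ ω ∂P, Y ω ≤ C) : ∫⁻ ω, ENNReal.ofReal (Real.log (Y ω)) ∂P ≠ ∞ := by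
  refine ((lintegral_mono_ae (g := fun _ => ENNReal.ofReal C) ?_).trans_lt ?_).ne
  · filter_upwards [hY0, hYC] with ω h0 hC
    exact ENNReal.ofReal_le_ofReal ((Real.log_le_self h0).trans hC)
  · rw [lintegral_const]
    exact ENNReal.mul_lt_top ENNReal.ofReal_lt_top (measure_lt_top _ _)

theorem integrable_of_lintegral_ofReal_ne_top (hY : AEMeasurable Y P)
    (hpos : ∫⁻ ω, ENNReal.ofReal (Y ω) ∂P ≠ ∞) (hneg : ∫⁻ ω, ENNReal.ofReal (-Y ω) ∂P ≠ ∞) :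
    Integrable Y P :=
  ((integrable_toReal_of_lintegral_ne_top hY.ennreal_ofReal hpos).sub
    (integrable_toReal_of_lintegral_ne_top hY.neg.ennreal_ofReal hneg)).congr <|
    ae_of_all _ fun ω => by simp [ENNReal.toReal_ofReal', max_zero_sub_max_neg_zero_eq_self]

theorem expectation_of_integrable (hY : Integrable Y P) :
    expectation P Y = ((∫ ω, Y ω ∂P : ℝ) : EReal) := by
  have hpos : ∫⁻ ω, ENNReal.ofReal (Y ω) ∂P ≠ ∞ := hY.lintegral_lt_top.ne
  have hneg : ∫⁻ ω, ENNReal.ofReal (-Y ω) ∂P ≠ ∞ := hY.neg.lintegral_lt_top.ne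
  rw [integral_eq_lintegral_pos_part_sub_lintegral_neg_part hY, EReal.coe_sub,
    EReal.coe_ennreal_toReal hpos, EReal.coe_ennreal_toReal hneg, expectation]

theorem expectation_of_not_integrable (hmeas : AEMeasurable Y P)
    (hpos : ∫⁻ ω, ENNReal.ofReal (Y ω) ∂P ≠ ∞) (hY : ¬ Integrable Y P) :
    expectation P Y = ⊥ := by
  have hneg : ∫⁻ ω, ENNReal.ofReal (-Y ω) ∂P = ∞ := by
    by_contra hneg
    exact hY (integrable_of_lintegral_ofReal_ne_top hmeas hpos hneg)
  rw [expectation, hneg, EReal.coe_ennreal_top, EReal.sub_top]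

theorem ofReal_lt_geomMean_iff (hmeas : AEMeasurable Y P)
    (hpos : ∫⁻ ω, ENNReal.ofReal (Real.log (Y ω)) ∂P ≠ ∞) {t : ℝ} (ht : 0 < t) :
    ENNReal.ofReal t < geomMean P Y ↔
      Integrable (fun ω => Real.log (Y ω)) P ∧ Real.log t < ∫ ω, Real.log (Y ω) ∂P := by
  by_cases hY : Integrable (fun ω => Real.log (Y ω)) P
  · rw [geomMean, expectation_of_integrable hY, EReal.exp_coe,
      ENNReal.ofReal_lt_ofReal_iff (Real.exp_pos _), ← Real.log_lt_iff_lt_exp ht,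
      and_iff_right hY]
  · have hlog : AEMeasurable (fun ω => Real.log (Y ω)) P := hmeas.log
    rw [geomMean, expectation_of_not_integrable hlog hpos hY, EReal.exp_bot]
    simp [hY]

end GeometricMean

section Sample

variable {Ω : Type*} [MeasurableSpace Ω] {P : Measure Ω} {X : ℕ → Ω → ℝ}
  (hmeas : ∀ n, Measurable (X n)) (hindep : iIndepFun X P)
  (hident : ∀ n, IdentDistrib (X n) (X 0) P P)

include hmeas hindep hident

theorem ae_frequently_eq_zero (h0 : P {ω | X 0 ω = 0} ≠ 0) :
    ∀ᵐ ω ∂P, ∃ᶠ n in atTop, X n ω = 0 :=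
  ae_frequently_mem hmeas hindep hident (measurableSet_singleton 0) h0

theorem ae_forall_ne_zero_or_frequently_eq_zero :
    ∀ᵐ ω ∂P, (∀ n, X n ω ≠ 0) ∨ ∃ᶠ n in atTop, X n ω = 0 := by
  by_cases h : P {ω | X 0 ω = 0} = 0
  · exact (ae_forall_ne_zero hident h).mono fun _ => Or.inl
  · exact (ae_frequently_eq_zero hmeas hindep hident h).mono fun _ => Or.inr

theorem ae_isWeightedShift_and_hasStepBlocks {H : Type*} [NormedAddCommGroup H]
    [InnerProductSpace ℂ H] (e : HilbertBasis ℕ ℂ H) (hnonneg : ∀ᵐ ω ∂P, 0 ≤ X 0 ω) {r R : ℝ}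
    (hr : IsLeast (essRan P (X 0)) r) (hR : IsGreatest (essRan P (X 0)) R) :
    ∀ᵐ ω ∂P, IsWeightedShift e (fun n => X n ω) (weightedShift e fun n => X n ω) ∧
      (∀ n, r ≤ |X n ω|) ∧ (∀ n, |X n ω| ≤ R) ∧ HasStepBlocks (fun n => X n ω) R r ∧
      ((∀ n, X n ω ≠ 0) ∨ ∃ᶠ n in atTop, X n ω = 0) := by
  filter_upwards [ae_forall_mem_Icc (hmeas 0) hident hr hR,
    ae_hasStepBlocks hmeas hindep hident hr.1 hR.1,
    ae_forall_ne_zero_or_frequently_eq_zero hmeas hindep hident] with ω hIcc hb hzero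
  have habs : ∀ n, |X n ω| = X n ω := fun n =>
    abs_of_nonneg ((essRan_nonneg hnonneg hr.1).trans (hIcc n).1)
  have hle : ∀ n, |X n ω| ≤ R := fun n => (habs n).trans_le (hIcc n).2
  exact ⟨weightedShift_apply_basis e ⟨R, hle⟩, fun n => (hIcc n).1.trans_eq (habs n).symm, hle,
    hb, hzero⟩

end Sample

/-! ### Coboundaries have mean zero -/

section Coboundary

variable {Ω : Type*} [MeasurableSpace Ω] {P : Measure Ω}

theorem integral_abs_le_of_integral_eq_zero {D G : Ω → ℝ} (hD : Integrable D P)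
    (hD0 : ∫ ω, D ω ∂P = 0) (hG : Integrable G P) (hDG : D ≤ᵐ[P] G) :
    ∫ ω, |D ω| ∂P ≤ 2 * ∫ ω, |G ω| ∂P := by
  have hle : ∀ᵐ ω ∂P, |D ω| ≤ 2 * |G ω| - D ω := by
    filter_upwards [hDG] with ω hω
    rcases abs_cases (D ω) with h | h <;> linarith [le_abs_self (G ω), abs_nonneg (G ω)]
  calc ∫ ω, |D ω| ∂P ≤ ∫ ω, (2 * |G ω| - D ω) ∂P :=
        integral_mono_ae hD.abs ((hG.abs.const_mul 2).sub hD) hle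
    _ = 2 * ∫ ω, |G ω| ∂P := by
        rw [integral_sub (hG.abs.const_mul 2) hD, hD0, sub_zero, integral_const_mul]

/-- The truncation of a real number to `[-k, k]`. -/
def clamp (k : ℕ) (x : ℝ) : ℝ := max (-k) (min k x)

theorem lipschitzWith_clamp (k : ℕ) : LipschitzWith 1 (clamp k) :=
  (LipschitzWith.id.const_min (k : ℝ)).const_max (-k)

theorem abs_clamp_sub_clamp_le (k : ℕ) (x y : ℝ) : |clamp k x - clamp k y| ≤ |x - y| := by
  simpa [Real.dist_eq] using (lipschitzWith_clamp k).dist_le_mul x y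

theorem clamp_sub_clamp_le {x y c : ℝ} (k : ℕ) (h : x - y ≤ c) :
    clamp k x - clamp k y ≤ |c| := by
  rcases le_total x y with hxy | hxy
  · have hmono : clamp k x ≤ clamp k y := max_le_max le_rfl (min_le_min le_rfl hxy)
    linarith [abs_nonneg c]
  · have hle := (le_abs_self _).trans (abs_clamp_sub_clamp_le k x y)
    rw [abs_of_nonneg (sub_nonneg.2 hxy)] at hle
    exact hle.trans (h.trans (le_abs_self c))

theorem tendsto_clamp (x : ℝ) : Tendsto (fun k => clamp k x) atTop (𝓝 x) := by
  obtain ⟨m, hm⟩ := exists_nat_ge |x|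
  refine tendsto_const_nhds.congr' ?_
  filter_upwards [eventually_ge_atTop m] with k hk
  have hxk : |x| ≤ k := hm.trans (by exact_mod_cast hk)
  rw [clamp, min_eq_right (abs_le.1 hxk).2, max_eq_right (abs_le.1 hxk).1]

theorem integrable_clamp_comp [IsFiniteMeasure P] {U : Ω → ℝ} (hU : AEMeasurable U P) (k : ℕ) :
    Integrable (fun ω => clamp k (U ω)) P :=
  Integrable.of_bound
    ((lipschitzWith_clamp k).continuous.comp_aestronglyMeasurable hU.aestronglyMeasurable) k <|
    ae_of_all _ fun _ => abs_le.2 ⟨le_max_left _ _, max_le (by simp) (min_le_left _ _)⟩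

theorem integrable_of_tendsto_of_integral_abs_le {D : ℕ → Ω → ℝ} {f : Ω → ℝ} {C : ℝ}
    (hD : ∀ k, Integrable (D k) P) (hC : ∀ k, ∫ ω, |D k ω| ∂P ≤ C)
    (hlim : ∀ᵐ ω ∂P, Tendsto (fun k => D k ω) atTop (𝓝 (f ω))) : Integrable f P := by
  refine ⟨aestronglyMeasurable_of_tendsto_ae atTop (fun k => (hD k).1) hlim, ?_⟩
  have hDC : ∀ k, ∫⁻ ω, ‖D k ω‖ₑ ∂P ≤ ENNReal.ofReal C := fun k => by
    rw [← ofReal_integral_norm_eq_lintegral_enorm (hD k)]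
    exact ENNReal.ofReal_le_ofReal (hC k)
  calc ∫⁻ ω, ‖f ω‖ₑ ∂P = ∫⁻ ω, liminf (fun k => ‖D k ω‖ₑ) atTop ∂P :=
        lintegral_congr_ae (hlim.mono fun ω hω => hω.enorm.liminf_eq.symm)
    _ ≤ liminf (fun k => ∫⁻ ω, ‖D k ω‖ₑ ∂P) atTop :=
        lintegral_liminf_le' fun k => (hD k).1.enorm
    _ ≤ ENNReal.ofReal C := liminf_le_of_le (by isBoundedDefault) fun b hb =>
        let ⟨k, hk⟩ := hb.exists; hk.trans (hDC k)
    _ < ∞ := ENNReal.ofReal_lt_top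

section

variable [IsFiniteMeasure P] {U V G : Ω → ℝ} (hUV : IdentDistrib U V P P) (hG : Integrable G P)
  (hle : ∀ᵐ ω ∂P, U ω - V ω ≤ G ω)

include hUV

theorem integral_clamp_sub_clamp (k : ℕ) : ∫ ω, (clamp k (U ω) - clamp k (V ω)) ∂P = 0 := by
  rw [integral_sub (integrable_clamp_comp hUV.aemeasurable_fst k)
    (integrable_clamp_comp hUV.aemeasurable_snd k), sub_eq_zero]
  exact (hUV.comp (lipschitzWith_clamp k).continuous.measurable).integral_eq

include hG hle

-- `U` and `V` themselves need not be integrable, hence the truncations.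
theorem integrable_sub_of_identDistrib : Integrable (fun ω => U ω - V ω) P := by
  have hint : ∀ k, Integrable (fun ω => clamp k (U ω) - clamp k (V ω)) P := fun k =>
    (integrable_clamp_comp hUV.aemeasurable_fst k).sub
      (integrable_clamp_comp hUV.aemeasurable_snd k)
  exact integrable_of_tendsto_of_integral_abs_le hint
    (fun k => integral_abs_le_of_integral_eq_zero (hint k) (integral_clamp_sub_clamp hUV k) hG.abs
      (hle.mono fun ω hω => clamp_sub_clamp_le k hω))
    (ae_of_all _ fun ω => (tendsto_clamp _).sub (tendsto_clamp _))

theorem integral_sub_eq_zero_of_identDistrib : ∫ ω, (U ω - V ω) ∂P = 0 := by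
  have hlim := tendsto_integral_of_dominated_convergence (fun ω => |U ω - V ω|)
    (F := fun k ω => clamp k (U ω) - clamp k (V ω))
    (fun k => ((integrable_clamp_comp hUV.aemeasurable_fst k).sub
      (integrable_clamp_comp hUV.aemeasurable_snd k)).1)
    (integrable_sub_of_identDistrib hUV hG hle).abs
    (fun k => ae_of_all _ fun ω => abs_clamp_sub_clamp_le k (U ω) (V ω))
    (ae_of_all _ fun ω => (tendsto_clamp (U ω)).sub (tendsto_clamp (V ω)))
  simp only [integral_clamp_sub_clamp hUV] at hlim
  exact tendsto_nhds_unique hlim tendsto_const_nhds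

end

end Coboundary

section IndepFun

variable {Ω : Type*} [MeasurableSpace Ω] {P : Measure Ω} {A : Set Ω}
  {W D G : Ω → ℝ} (hA : MeasurableSet A) (hPA : P A ≠ 0) (hW : Integrable W P)
  (hWA : ∀ᵐ ω ∂P, ω ∈ A → W ω < D ω) (hWA' : ∀ᵐ ω ∂P, ω ∉ A → W ω = 0)
  (hD : AEStronglyMeasurable D P) (hG : Integrable G P) (hDG : D ≤ᵐ[P] G)
  (hindep : IndepFun D (A.indicator 1 : Ω → ℝ) P)

include hA hW hWA hWA' hD hG hDG

theorem integrable_mul_indicator_of_lt : Integrable (fun ω => D ω * A.indicator 1 ω) P := by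
  refine integrable_of_le_of_le (hD.mul (stronglyMeasurable_one.indicator hA).aestronglyMeasurable)
    ?_ ?_ hW hG.abs
  · filter_upwards [hWA, hWA'] with ω h h'
    by_cases hω : ω ∈ A <;> simp [hω, h', (h _).le]
  · filter_upwards [hDG] with ω h
    by_cases hω : ω ∈ A <;> simp [hω, h.trans (le_abs_self _)]

include hPA hindep

theorem integrable_of_indepFun_of_lt : Integrable D P := by
  refine hindep.integrable_left_of_integrable_op (· * ·) 1 one_ne_zero (fun x y => ?_)
    (integrable_mul_indicator_of_lt hA hW hWA hWA' hD hG hDG) hD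
    (stronglyMeasurable_one.indicator hA).aestronglyMeasurable fun h => ?_
  · rw [ENNReal.coe_one, one_mul, enorm_mul]
  · rw [Set.indicator_ae_eq_zero] at h
    exact hPA (by simpa using h)

theorem integral_pos_of_indepFun_of_lt (hW0 : ∫ ω, W ω ∂P = 0) : 0 < ∫ ω, D ω ∂P := by
  have hint := integrable_mul_indicator_of_lt hA hW hWA hWA' hD hG hDG
  have hle : W ≤ᵐ[P] fun ω => D ω * A.indicator 1 ω := by
    filter_upwards [hWA, hWA'] with ω h h'
    by_cases hω : ω ∈ A <;> simp [hω, h', (h _).le]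
  have hlt : 0 < ∫ ω, D ω * A.indicator 1 ω ∂P := by
    rw [← hW0]
    refine (integral_mono_ae hW hint hle).lt_of_ne fun heq => hPA ?_
    refine measure_eq_zero_iff_ae_notMem.2 ?_
    filter_upwards [(integral_eq_iff_of_ae_le hW hint hle).1 heq, hWA] with ω h h' hω
    exact (h' hω).ne (by simpa [hω] using h)
  rw [hindep.integral_fun_mul_eq_mul_integral hD
    (stronglyMeasurable_one.indicator hA).aestronglyMeasurable] at hlt
  exact pos_of_mul_pos_left hlt (integral_nonneg (Set.indicator_nonneg fun _ _ => zero_le_one))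

end IndepFun

theorem integrable_and_integral_pos_of_identDistrib {Ω : Type*} [MeasurableSpace Ω] {P : Measure Ω}
    [IsFiniteMeasure P] {A : Set Ω} {U V D G : Ω → ℝ} (hUV : IdentDistrib U V P P)
    (hA : MeasurableSet A) (hPA : P A ≠ 0) (hlt : ∀ᵐ ω ∂P, ω ∈ A → U ω - V ω < D ω)
    (hzero : ∀ᵐ ω ∂P, ω ∉ A → U ω - V ω = 0) (hD : AEStronglyMeasurable D P)
    (hG : Integrable G P) (hDG : D ≤ᵐ[P] G) (hindep : IndepFun D (A.indicator 1 : Ω → ℝ) P) :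
    Integrable D P ∧ 0 < ∫ ω, D ω ∂P := by
  have hle : ∀ᵐ ω ∂P, U ω - V ω ≤ |G ω| := by
    filter_upwards [hlt, hzero, hDG] with ω hltω hzeroω hDGω
    by_cases hω : ω ∈ A
    · exact (hltω hω).le.trans (hDGω.trans (le_abs_self _))
    · exact (hzeroω hω).trans_le (abs_nonneg _)
  have hint := integrable_sub_of_identDistrib hUV hG.abs hle
  exact ⟨integrable_of_indepFun_of_lt hA hPA hint hlt hzero hD hG hDG hindep,
    integral_pos_of_indepFun_of_lt hA hPA hint hlt hzero hD hG hDG hindep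
      (integral_sub_eq_zero_of_identDistrib hUV hG.abs hle)⟩

/-! ### The convergence threshold of the series -/

section LogSumSqProd

variable {t : ℝ} {x : ℕ → ℝ}

theorem measurable_sumSqProd (t : ℝ) : Measurable (sumSqProd t) :=
  Measurable.tsum fun _ => ((Finset.measurable_fun_prod _ fun i _ =>
    measurable_const.div (measurable_pi_apply i)).pow_const 2).ennreal_ofReal

theorem sumSqProd_eq_top_iff_tail (ht : t ≠ 0) (hx : x 0 ≠ 0) :
    sumSqProd t x = ∞ ↔ sumSqProd t (fun n => x (n + 1)) = ∞ := by
  have hpos : ENNReal.ofReal ((t / x 0) ^ 2) ≠ 0 :=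
    (ENNReal.ofReal_pos.2 (by positivity)).ne'
  simp [sumSqProd_eq_one_add t x, ENNReal.mul_eq_top, hpos]

/-- The logarithm of `sumSqProd t x`, with the value `0` where the series diverges. -/
def logSumSqProd (t : ℝ) (x : ℕ → ℝ) : ℝ := Real.log (sumSqProd t x).toReal

theorem measurable_logSumSqProd (t : ℝ) : Measurable (logSumSqProd t) :=
  (measurable_sumSqProd t).ennreal_toReal.log

theorem logSumSqProd_tail_sub_eq_zero (ht : t ≠ 0) (hx : x 0 ≠ 0)
    (h : sumSqProd t (fun n => x (n + 1)) = ∞) :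
    logSumSqProd t (fun n => x (n + 1)) - logSumSqProd t x = 0 := by
  simp [logSumSqProd, h, (sumSqProd_eq_top_iff_tail ht hx).2 h]

theorem logSumSqProd_tail_sub_lt (ht : t ≠ 0) (hx : x 0 ≠ 0)
    (h : sumSqProd t (fun n => x (n + 1)) ≠ ∞) :
    logSumSqProd t (fun n => x (n + 1)) - logSumSqProd t x < 2 * (Real.log (x 0) - Real.log t) := by
  have hF : 0 < (sumSqProd t fun n => x (n + 1)).toReal :=
    ENNReal.toReal_pos (by simp [sumSqProd_eq_one_add t fun n => x (n + 1)]) h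
  have hrec : (sumSqProd t x).toReal =
      1 + (sumSqProd t fun n => x (n + 1)).toReal * (t / x 0) ^ 2 := by
    rw [sumSqProd_eq_one_add, ENNReal.toReal_add ENNReal.one_ne_top (by finiteness),
      ENNReal.toReal_mul, ENNReal.toReal_ofReal (sq_nonneg _), ENNReal.toReal_one]
  have hlog : logSumSqProd t (fun n => x (n + 1)) + 2 * (Real.log t - Real.log (x 0)) =
      Real.log ((sumSqProd t fun n => x (n + 1)).toReal * (t / x 0) ^ 2) := by
    rw [Real.log_mul hF.ne' (by positivity), Real.log_pow, Real.log_div ht hx, logSumSqProd,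
      Nat.cast_two]
  have hlt := Real.log_lt_log (mul_pos hF (by positivity)) <|
    lt_one_add ((sumSqProd t fun n => x (n + 1)).toReal * (t / x 0) ^ 2)
  rw [← hrec, ← hlog, ← logSumSqProd] at hlt
  linarith

theorem sumSqProd_ne_top_of_tendsto (hx : ∀ n, x n ≠ 0) (ht : t ≠ 0) {L : ℝ}
    (hL : Tendsto (fun n : ℕ => (∑ i ∈ range n, Real.log (x i)) / n) atTop (𝓝 L))
    (htL : Real.log t < L) : sumSqProd t x ≠ ∞ := by
  obtain ⟨M, htM, hML⟩ := exists_between htL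
  have hexp : ∀ n, (∏ i ∈ range n, t / x i) ^ 2 =
      Real.exp (n * Real.log t - ∑ i ∈ range n, Real.log (x i)) ^ 2 := fun n => by
    have hlog : Real.log (∏ i ∈ range n, t / x i) =
        n * Real.log t - ∑ i ∈ range n, Real.log (x i) := by
      rw [Real.log_prod fun i _ => div_ne_zero ht (hx i)]
      simp [Real.log_div ht (hx _)]
    rw [← hlog, Real.exp_log_eq_abs (prod_ne_zero_iff.2 fun i _ => div_ne_zero ht (hx i)), sq_abs]
  have hgeom : Summable fun n : ℕ => Real.exp (2 * (Real.log t - M)) ^ n :=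
    summable_geometric_of_lt_one (Real.exp_nonneg _) (Real.exp_lt_one_iff.2 (by linarith))
  refine sumSqProd_ne_top_iff.2 (hgeom.of_norm_bounded_eventually_nat ?_)
  filter_upwards [hL.eventually_const_lt hML, eventually_gt_atTop 0] with n hn hn0
  rw [lt_div_iff₀ (by exact_mod_cast hn0)] at hn
  rw [Real.norm_of_nonneg (sq_nonneg _), hexp, ← Real.exp_nat_mul, ← Real.exp_nat_mul,
    Real.exp_le_exp]
  push_cast
  linarith

end LogSumSqProd

section Threshold

variable {Ω : Type*} [MeasurableSpace Ω] {P : Measure Ω} {X : ℕ → Ω → ℝ}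
  (hmeas : ∀ n, Measurable (X n)) (hindep : iIndepFun X P)

include hindep

theorem indepFun_zero_tail (hmeas : ∀ n, Measurable (X n)) :
    IndepFun (X 0) (fun ω n => X (n + 1) ω) P := by
  rw [IndepFun_iff_Indep]
  refine indep_of_indep_of_le_left (indep_of_indep_of_le_right
    (indep_iSup_of_disjoint (fun i => (hmeas i).comap_le) hindep
      (disjoint_compl_right (a := ({0} : Set ℕ)))) ?_) ?_
  · rw [MeasurableSpace.pi, MeasurableSpace.comap_iSup]
    refine iSup_le fun n => ?_
    rw [MeasurableSpace.comap_comp]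
    exact le_iSup₂_of_le (n + 1) n.succ_ne_zero le_rfl
  · exact le_iSup₂_of_le 0 rfl le_rfl

variable (hident : ∀ n, IdentDistrib (X n) (X 0) P P)

include hident

theorem identDistrib_tail : IdentDistrib (fun ω n => X (n + 1) ω) (fun ω n => X n ω) P P :=
  IdentDistrib.pi (fun n => (hident (n + 1)).trans (hident n).symm)
    (hindep.precomp (add_left_injective 1)) hindep

variable (hlog : ∫⁻ ω, ENNReal.ofReal (Real.log (X 0 ω)) ∂P ≠ ∞)

include hmeas hlog

theorem integrable_log_sub_and_integral_pos (hne : ∀ᵐ ω ∂P, X 0 ω ≠ 0) {t : ℝ} (ht : t ≠ 0)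
    (hfin : P {ω | sumSqProd t (fun n => X n ω) ≠ ∞} ≠ 0) :
    Integrable (fun ω => 2 * (Real.log (X 0 ω) - Real.log t)) P ∧
      0 < ∫ ω, 2 * (Real.log (X 0 ω) - Real.log t) ∂P := by
  have := hindep.isProbabilityMeasure
  have hlogm : Measurable fun ω => Real.log (X 0 ω) := (hmeas 0).log
  have htail := identDistrib_tail hindep hident
  have hS : MeasurableSet {x | sumSqProd t x ≠ ∞} :=
    (measurable_sumSqProd t (measurableSet_singleton ∞)).compl
  have hA : MeasurableSet {ω | sumSqProd t (fun n => X (n + 1) ω) ≠ ∞} :=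
    measurable_pi_lambda _ (fun n => hmeas (n + 1)) hS
  have hPA : P {ω | sumSqProd t (fun n => X (n + 1) ω) ≠ ∞} ≠ 0 :=
    (htail.measure_mem_eq hS).trans_ne hfin
  have hG : Integrable
      (fun ω => 2 * ((ENNReal.ofReal (Real.log (X 0 ω))).toReal - Real.log t)) P :=
    ((integrable_toReal_of_lintegral_ne_top hlogm.ennreal_ofReal.aemeasurable hlog).sub
      (integrable_const _)).const_mul 2
  have hD : Measurable fun ω => 2 * (Real.log (X 0 ω) - Real.log t) :=
    (hlogm.sub_const _).const_mul 2
  have hUV : IdentDistrib (fun ω => logSumSqProd t fun n => X (n + 1) ω)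
      (fun ω => logSumSqProd t fun n => X n ω) P P := htail.comp (measurable_logSumSqProd t)
  refine integrable_and_integral_pos_of_identDistrib hUV hA hPA ?_ ?_
    hD.aestronglyMeasurable hG ?_ ?_
  · filter_upwards [hne] with ω h hω
    exact logSumSqProd_tail_sub_lt (x := fun n => X n ω) ht h hω
  · filter_upwards [hne] with ω h hω
    exact logSumSqProd_tail_sub_eq_zero (x := fun n => X n ω) ht h (not_not.1 hω)
  · refine ae_of_all _ fun ω => mul_le_mul_of_nonneg_left (sub_le_sub_right ?_ _) zero_le_two
    exact (le_max_left _ 0).trans_eq ENNReal.toReal_ofReal'.symm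
  · exact (indepFun_zero_tail hindep hmeas).comp (φ := fun y => 2 * (Real.log y - Real.log t))
      (ψ := {x | sumSqProd t x ≠ ∞}.indicator 1) (by fun_prop) (measurable_one.indicator hS)

theorem ofReal_lt_geomMean_of_sumSqProd_ne_top (hne : ∀ᵐ ω ∂P, X 0 ω ≠ 0) {t : ℝ} (ht : 0 < t)
    (hfin : P {ω | sumSqProd t (fun n => X n ω) ≠ ∞} ≠ 0) :
    ENNReal.ofReal t < geomMean P (X 0) := by
  have := hindep.isProbabilityMeasure
  obtain ⟨hD, hpos⟩ :=
    integrable_log_sub_and_integral_pos hmeas hindep hident hlog hne ht.ne' hfin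
  have hint : Integrable (fun ω => Real.log (X 0 ω)) P :=
    ((hD.div_const 2).add (integrable_const (Real.log t))).congr <| ae_of_all _ fun ω => by simp
  refine (ofReal_lt_geomMean_iff (hmeas 0).aemeasurable hlog ht).2 ⟨hint, ?_⟩
  rw [integral_const_mul, integral_sub hint (integrable_const _)] at hpos
  simpa using hpos

variable (hne : ∀ᵐ ω ∂P, ∀ n, X n ω ≠ 0)

include hne

theorem ae_forall_sumSqProd_eq_top :
    ∀ᵐ ω ∂P, ∀ t > 0, geomMean P (X 0) ≤ ENNReal.ofReal t → sumSqProd t (fun n => X n ω) = ∞ := by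
  rcases eq_or_ne (geomMean P (X 0)) ∞ with hg | hg
  · simp [hg]
  let s : ℕ → ℝ := fun k => max (geomMean P (X 0)).toReal (1 / (k + 1))
  have hs : ∀ k, 0 < s k := fun k => lt_max_of_lt_right Nat.one_div_pos_of_nat
  have hdiv : ∀ᵐ ω ∂P, ∀ k, sumSqProd (s k) (fun n => X n ω) = ∞ := by
    refine ae_all_iff.2 fun k => by_contra fun hk => ?_
    refine (ofReal_lt_geomMean_of_sumSqProd_ne_top hmeas hindep hident hlog
      (hne.mono fun ω h => h 0) (hs k) hk).not_ge ?_
    exact (ENNReal.ofReal_toReal hg).ge.trans (ENNReal.ofReal_le_ofReal (le_max_left _ _))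
  filter_upwards [hdiv] with ω hω t ht hgt
  obtain ⟨k, hk⟩ := exists_nat_one_div_lt ht
  exact top_unique <| (hω k).ge.trans <|
    sumSqProd_mono (hs k).le (max_le (ENNReal.toReal_le_of_le_ofReal ht.le hgt) hk.le) _

theorem ae_forall_sumSqProd_ne_top :
    ∀ᵐ ω ∂P, ∀ t > 0, ENNReal.ofReal t < geomMean P (X 0) → sumSqProd t (fun n => X n ω) ≠ ∞ := by
  by_cases hint : Integrable (fun ω => Real.log (X 0 ω)) P
  · filter_upwards [hne, strong_law_ae_real (fun n ω => Real.log (X n ω)) hint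
      (fun i j hij => (hindep.indepFun hij).comp Real.measurable_log Real.measurable_log)
      (fun n => (hident n).comp Real.measurable_log)] with ω hω hlim t ht htg
    exact sumSqProd_ne_top_of_tendsto hω ht.ne' hlim
      ((ofReal_lt_geomMean_iff (hmeas 0).aemeasurable hlog ht).1 htg).2
  · refine ae_of_all _ fun ω t ht htg => absurd ?_ hint
    exact ((ofReal_lt_geomMean_iff (hmeas 0).aemeasurable hlog ht).1 htg).1

theorem ae_setOf_sumSqProd_ne_top_eq :
    ∀ᵐ ω ∂P, {z : ℂ | sumSqProd ‖z‖ (fun n => X n ω) ≠ ∞} =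
      {0} ∪ {z : ℂ | ENNReal.ofReal ‖z‖ < geomMean P (X 0)} := by
  filter_upwards [ae_forall_sumSqProd_eq_top hmeas hindep hident hlog hne,
    ae_forall_sumSqProd_ne_top hmeas hindep hident hlog hne] with ω htop hfin
  ext z
  rw [Set.singleton_union, Set.mem_insert_iff, Set.mem_ofPred_eq, Set.mem_ofPred_eq]
  rcases eq_or_ne z 0 with rfl | hz
  · simp [sumSqProd_zero]
  · rw [or_iff_right hz]
    exact ⟨fun h => lt_of_not_ge fun hg => h (htop _ (norm_pos_iff.2 hz) hg),
      hfin _ (norm_pos_iff.2 hz)⟩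

end Threshold

end RandomShift

end

theorem theorem3p1
    {H : Type*} [NormedAddCommGroup H] [InnerProductSpace ℂ H] [CompleteSpace H]
    (e : HilbertBasis ℕ ℂ H)
    {Ω : Type*} [MeasurableSpace Ω] (P : Measure Ω) [IsProbabilityMeasure P]
    (X : ℕ → Ω → ℝ)
    (hmeas : ∀ n, Measurable (X n))
    (hindep : iIndepFun X P)
    (hident : ∀ n, IdentDistrib (X n) (X 0) P P)
    (hnonneg : ∀ n, ∀ᵐ ω ∂P, 0 ≤ X n ω)
    (hbdd : ∃ C : ℝ, ∀ n, ∀ᵐ ω ∂P, X n ω ≤ C)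
    (r R : ℝ)
    (hr : IsLeast (RandomShift.essRan P (X 0)) r)
    (hR : IsGreatest (RandomShift.essRan P (X 0)) R)
    (hRpos : 0 < R)
    (T : Ω → H →L[ℂ] H)
    (hT : T = fun ω => RandomShift.weightedShift e (fun n => X n ω)) :
    -- almost every sample is the bounded weighted shift with the given weights
    (∀ᵐ ω ∂P, ∀ n, T ω (e n) = (X n ω : ℂ) • e (n + 1)) ∧
    -- norm, essential norm, spectral radius, numerical radius
    (∀ᵐ ω ∂P, ‖T ω‖ = R ∧ RandomShift.essNorm (T ω) = R ∧
      spectralRadius ℂ (T ω) = ENNReal.ofReal R ∧ RandomShift.numericalRadius (T ω) = R) ∧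
    -- spectrum and approximate defect spectrum
    (∀ᵐ ω ∂P, spectrum ℂ (T ω) = Metric.closedBall 0 R ∧
      RandomShift.approxDefectSpectrum (T ω) = Metric.closedBall 0 R) ∧
    -- approximate point, essential and Wolf spectra; the index
    (∀ᵐ ω ∂P, RandomShift.approxPointSpectrum (T ω) = {z : ℂ | r ≤ ‖z‖ ∧ ‖z‖ ≤ R} ∧
      RandomShift.essSpectrum (T ω) = {z : ℂ | r ≤ ‖z‖ ∧ ‖z‖ ≤ R} ∧
      RandomShift.wolfSpectrum (T ω) = {z : ℂ | r ≤ ‖z‖ ∧ ‖z‖ ≤ R}) ∧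
    (∀ᵐ ω ∂P, ∀ z ∈ Metric.ball (0 : ℂ) r,
      (RandomShift.shifted (T ω) z).IsFredholm ∧
        RandomShift.index (RandomShift.shifted (T ω) z) = -1) ∧
    -- point spectra when zero weights occur with positive probability
    (0 < P {ω | X 0 ω = 0} →
      ∀ᵐ ω ∂P, RandomShift.pointSpectrum (T ω) = {0} ∧
        RandomShift.pointSpectrum (ContinuousLinearMap.adjoint (T ω)) = {0} ∧
        ¬ FiniteDimensional ℂ (T ω).ker ∧
        ¬ FiniteDimensional ℂ (ContinuousLinearMap.adjoint (T ω)).ker) ∧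
    -- point spectra when the weights are almost surely positive
    (P {ω | X 0 ω = 0} = 0 →
      ∀ᵐ ω ∂P, RandomShift.pointSpectrum (T ω) = ∅ ∧
        RandomShift.pointSpectrum (ContinuousLinearMap.adjoint (T ω)) =
          {0} ∪ {z : ℂ | ENNReal.ofReal ‖z‖ < RandomShift.geomMean P (X 0)} ∧
        ∀ z ∈ RandomShift.pointSpectrum (ContinuousLinearMap.adjoint (T ω)),
          Module.finrank ℂ (RandomShift.shifted (ContinuousLinearMap.adjoint (T ω)) z).ker = 1) ∧
    -- numerical range and essential numerical range
    (∀ᵐ ω ∂P, RandomShift.numericalRange (T ω) = Metric.ball 0 R) ∧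
    (∀ᵐ ω ∂P, RandomShift.essNumericalRange (T ω) = Metric.closedBall 0 R) := by
  subst hT
  have hr0 : 0 ≤ r := RandomShift.essRan_nonneg (hnonneg 0) hr.1
  have hshift := RandomShift.ae_isWeightedShift_and_hasStepBlocks hmeas hindep hident e
    (hnonneg 0) hr hR
  refine ⟨hshift.mono fun _ h => h.1, ?_, ?_, ?_, ?_, fun h0 => ?_, fun h0 => ?_, ?_, ?_⟩
  · filter_upwards [hshift] with ω ⟨hT, hge, hle, hb, hz⟩
    exact ⟨hT.norm_eq hRpos hb.hasFlatBlocks_left hle,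
      hT.essNorm_eq hRpos hb.hasFlatBlocks_left hle,
      RandomShift.spectralRadius_eq_of_spectrum_eq_closedBall hRpos.le
        (hT.spectrum_eq hr0 hge hle hb hz),
      RandomShift.numericalRadius_eq_of_numericalRange_eq_ball hRpos
        (hT.numericalRange_eq hRpos hb.hasFlatBlocks_left hle)⟩
  · filter_upwards [hshift] with ω ⟨hT, hge, hle, hb, hz⟩
    exact ⟨hT.spectrum_eq hr0 hge hle hb hz, hT.approxDefectSpectrum_eq hr0 hge hle hb hz⟩
  · filter_upwards [hshift] with ω ⟨hT, hge, hle, hb, hz⟩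
    exact ⟨hT.approxPointSpectrum_eq hr0 hge hle hb, hT.essSpectrum_eq hr0 hge hle hb hz,
      hT.wolfSpectrum_eq hr0 hge hle hb hz⟩
  · filter_upwards [hshift] with ω ⟨hT, hge, _⟩ z hz
    rw [mem_ball_zero_iff] at hz
    exact ⟨hT.isFredholm_shifted hge hz, hT.index_shifted hge hz⟩
  · filter_upwards [hshift, RandomShift.ae_frequently_eq_zero hmeas hindep hident h0.ne']
      with ω ⟨hT, _⟩ hw
    exact ⟨hT.pointSpectrum_of_frequently_zero hw, hT.pointSpectrum_adjoint_of_frequently_zero hw,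
      hT.not_finiteDimensional_ker hw, hT.not_finiteDimensional_ker_adjoint hw⟩
  · have hne := RandomShift.ae_forall_ne_zero hident h0
    have hlog := RandomShift.lintegral_ofReal_log_ne_top (hnonneg 0) (hbdd.choose_spec 0)
    filter_upwards [hshift, hne,
      RandomShift.ae_setOf_sumSqProd_ne_top_eq hmeas hindep hident hlog hne] with ω ⟨hT, _⟩ hw hsum
    exact ⟨Set.eq_empty_of_forall_notMem fun z => hT.notMem_pointSpectrum (Or.inr hw),
      (hT.pointSpectrum_adjoint hw).trans hsum, fun z => hT.finrank_ker_shifted_adjoint hw⟩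
  · filter_upwards [hshift] with ω ⟨hT, _, hle, hb, _⟩
    exact hT.numericalRange_eq hRpos hb.hasFlatBlocks_left hle
  · filter_upwards [hshift] with ω ⟨hT, _, hle, hb, _⟩
    exact hT.essNumericalRange_eq hRpos hb.hasFlatBlocks_left hle
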